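/- Let $\Phi$ be an irreducible reduced crystallographic root system with simple roots $\{\alpha_i\mid i\in I\}$, and let $(\beta,\alpha^\vee)\in\mathbb{Z}$ denote the pairing of a root $\beta$ with the coroot of a root $\alpha$. For roots $\alpha\ne\pm\beta$ let $\beta-q\alpha,\ldots,\beta,\ldots,\beta+p\alpha$ be the $\alpha$-string through $\beta$, and put $m^-_\alpha(\beta)=q+1$, $m^+_\alpha(\beta)=p+1$. Let $M$ be the complex vector space with basis $\{u_i\mid i\in I\}\cup\{v_\alpha\mid\alpha\in\Phi\}$. Define linear maps $e_i,f_i,h_i\colon M\to M$ ($i\in I$) by $$e_i(u_j)=|(\alpha_i,\alpha_j^\vee)|\,v_{\alpha_i},\qquad f_i(u_j)=|(\alpha_i,\alpha_j^\vee)|\,v_{-\alpha_i},\qquad h_i(u_j)=0,\qquad h_i(v_\alpha)=(\alpha,\alpha_i^\vee)v_\alpha,$$ where $e_i(v_\alpha)=m^-_{\alpha_i}(\alpha)v_{\alpha+\alpha_i}$ if $\alpha+\alpha_i\in\Phi$, $e_i(v_{-\alpha_i})=u_i$, and $e_i(v_\alpha)=0$ otherwise; and $f_i(v_\alpha)=m^+_{\alpha_i}(\alpha)v_{\alpha-\alpha_i}$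 if $\alpha-\alpha_i\in\Phi$, $f_i(v_{\alpha_i})=u_i$, and $f_i(v_\alpha)=0$ otherwise. For $\alpha\in\Phi$ let $h_\alpha\colon M\to M$ be given by $h_\alpha(u_j)=0$ and $h_\alpha(v_\beta)=(\beta,\alpha^\vee)v_\beta$. Let $\mathfrak g\subseteq\mathfrak{gl}(M)$ be the Lie algebra generated by all $e_i,f_i$; it contains all $h_i=[e_i,f_i]$ and all $h_\alpha$. Let $\tilde\omega\colon\mathfrak g\to\mathfrak g$ be the automorphism given by conjugation with $\omega\colon M\to M$, where $\omega(u_i)=u_i$ and $\omega(v_\alpha)=v_{-\alpha}$. Let $\epsilon\colon I\to\{\pm1\}$ satisfy $\epsilon(i)=-\epsilon(j)$ whenever $i\neq j$ and $(\alpha_i,\alpha_j^\vee)\ne0$. Then there is a unique isomorphism of $\mathfrak g$-modules $\varphi\colon M\to\mathfrak g$ (with $\mathfrak g$ acting on itself by the adjoint representation) such that $\varphi(v_{\alpha_i})=\epsilon(i)e_i$, $\varphi(v_{-\alpha_i})=-\epsilon(i)f_i$ and $\varphi(u_i)=-\epsilon(i)h_i$ for all $i\in I$. Put $\mathbf e^\epsilon_\alpha=\varphi(v_\alpha)$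 for $\alpha\in\Phi$. Then $\{h_i\mid i\in I\}\cup\{\mathbf e^\epsilon_\alpha\mid\alpha\in\Phi\}$ is a basis of $\mathfrak g$, and: (a) $\tilde\omega(\mathbf e^\epsilon_\alpha)=-\mathbf e^\epsilon_{-\alpha}$ for all $\alpha\in\Phi$; (b) $[\mathbf e^\epsilon_\alpha,\mathbf e^\epsilon_{-\alpha}]=(-1)^{\mathrm{ht}(\alpha)}h_\alpha$ for all $\alpha\in\Phi$, where $\mathrm{ht}(\alpha)$ is the height of $\alpha$; (c) if $\alpha,\beta,\alpha+\beta\in\Phi$, then $[\mathbf e^\epsilon_\alpha,\mathbf e^\epsilon_\beta]=N^\epsilon_{\alpha,\beta}\,\mathbf e^\epsilon_{\alpha+\beta}$ with $N^\epsilon_{\alpha,\beta}=\pm m^-_\alpha(\beta)$. Moreover, put $\hat e_\alpha=\mathbf e^\epsilon_\alpha$ if $\mathrm{ht}(\alpha)$ is even and $\hat e_\alpha=\sqrt{-1}\,\mathbf e^\epsilon_\alpha$ if $\mathrm{ht}(\alpha)$ is odd. Then $\tilde\omega(\hat e_\alpha)=-\hat e_{-\alpha}$ for all $\alpha\in\Phi$,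 and $\{h_i\mid i\in I\}\cup\{\hat e_\alpha\mid\alpha\in\Phi\}$ is a Chevalley basis of $\mathfrak g$; that is, it is a vector space basis of $\mathfrak g$ such that, for all $i,j\in I$ and $\alpha,\beta\in\Phi$: $[h_i,h_j]=0$; $[h_i,\hat e_\alpha]=(\alpha,\alpha_i^\vee)\hat e_\alpha$; $[\hat e_\alpha,\hat e_{-\alpha}]=h_\alpha$; if $\alpha+\beta\in\Phi$, then $[\hat e_\alpha,\hat e_\beta]=N_{\alpha,\beta}\hat e_{\alpha+\beta}$ and $[\hat e_{-\alpha},\hat e_{-\beta}]=-N_{\alpha,\beta}\hat e_{-\alpha-\beta}$ with $N_{\alpha,\beta}=\pm m^-_\alpha(\beta)$; and $[\hat e_\alpha,\hat e_\beta]=0$ if $0\neq\alpha+\beta\notin\Phi$. -/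

import Mathlib

open RootPairing RootPairing.GeckConstruction

attribute [local instance 100] LieRing.ofAssociativeRing

namespace GeckChevalley

/-- The index of the root `-α` (see `root_negIdx`). -/
def negIdx {ι V W : Type*} [AddCommGroup V] [Module ℂ V] [AddCommGroup W] [Module ℂ W]
    (P : RootPairing ι ℂ V W) (α : ι) : ι :=
  P.reflectionPerm α α

theorem root_negIdx {ι V W : Type*} [AddCommGroup V] [Module ℂ V] [AddCommGroup W] [Module ℂ W]
    (P : RootPairing ι ℂ V W) (α : ι) : P.root (negIdx P α) = -P.root α := by
  simp [negIdx]

section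

variable {ι V W : Type*} [Fintype ι] [DecidableEq ι]
  [AddCommGroup V] [Module ℂ V] [AddCommGroup W] [Module ℂ W]
  {P : RootPairing ι ℂ V W} [P.IsCrystallographic] (b : P.Base)

/-- The complex vector space `M` with basis `u i` (`i` simple), `v α` (`α` a root). The maps
`e i`, `f i`, `h i`, `ω` on `M` are written as matrices with respect to this basis. -/
abbrev Space : Type _ := b.support ⊕ ι → ℂ

/-- The Lie algebra `𝔤` of endomorphisms of `M` generated by the `e i`, `f i`
(and `h i = ⁅e i, f i⁆`). -/
abbrev Alg : Type _ := lieAlgebra b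

/-- `e i` as an element of `𝔤`. -/
noncomputable def eG (i : b.support) : Alg b := ⟨e i, e_mem_lieAlgebra i⟩

/-- `f i` as an element of `𝔤`. -/
noncomputable def fG (i : b.support) : Alg b := ⟨f i, f_mem_lieAlgebra i⟩

/-- `h i` as an element of `𝔤`. -/
noncomputable def hG (i : b.support) : Alg b := ⟨h i, h_mem_lieAlgebra i⟩

/-- The diagonal map `h_α` on `M` with `h_α (u j) = 0` and `h_α (v β) = (β, α^∨) v β`. -/
noncomputable def corootMatrix (α : ι) : Matrix (b.support ⊕ ι) (b.support ⊕ ι) ℂ :=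
  Matrix.diagonal (Sum.elim 0 fun β => (P.pairingIn ℤ β α : ℂ))

theorem corootMatrix_mem (α : ι) : corootMatrix b α ∈ lieAlgebra b := by
  refine cartanSubalgebra_le_lieAlgebra ?_
  change corootMatrix b α ∈ Submodule.span ℂ (Set.range h)
  rw [corootMatrix, diagonal_elim_mem_span_h_iff]
  let L : W →ₗ[ℂ] (ι → ℂ) := LinearMap.pi fun β => P.toLinearMap (P.root β)
  have hL (γ : ι) : L (P.coroot γ) = fun β => (P.pairingIn ℤ β γ : ℂ) := by
    ext β
    have := P.algebraMap_pairingIn ℤ β γ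
    simp only [algebraMap_int_eq, eq_intCast] at this
    simp [L, this]
  have h1 : P.coroot α ∈ Submodule.span ℂ (P.coroot '' b.support) := by
    rw [b.span_coroot_support]
    exact Submodule.subset_span ⟨α, rfl⟩
  have h2 := Submodule.mem_map_of_mem (f := L) h1
  rw [Submodule.map_span, hL] at h2
  refine Submodule.span_mono ?_ h2
  rintro _ ⟨_, ⟨i, hi, rfl⟩, rfl⟩
  exact ⟨⟨i, hi⟩, (hL i).symm⟩

/-- `h_α` as an element of `𝔤`. -/
noncomputable def corootG (α : ι) : Alg b := ⟨corootMatrix b α, corootMatrix_mem b α⟩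

/-- The automorphism of `𝔤` given by conjugation with the involution `ω` of `M`, where
`ω (u j) = u j` and `ω (v α) = v (-α)`. -/
noncomputable def omegaG : Alg b ≃ₗ⁅ℂ⁆ Alg b where
  toFun x := ⟨ωConj b x, ωConj_mem_of_mem x.2⟩
  invFun x := ⟨ωConj b x, ωConj_mem_of_mem x.2⟩
  map_add' x y := Subtype.ext (by simp [mul_add, add_mul])
  map_smul' t x := Subtype.ext (by simp)
  map_lie' {x y} := Subtype.ext ((ωConj b).map_lie x.1 y.1)
  left_inv x := Subtype.ext ((ωConj b).left_inv x.1)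
  right_inv x := Subtype.ext ((ωConj b).left_inv x.1)

/-- The sign condition on `ε : I → {±1}`: adjacent vertices of the Dynkin diagram have
opposite signs. -/
def IsAlternating (ε : b.support → ℤˣ) : Prop :=
  ∀ i j : b.support, i ≠ j → b.cartanMatrix i j ≠ 0 → ε i = -ε j

/-- The normalisation, by `ε`, of an isomorphism of `𝔤`-modules `M ≃ 𝔤` (`𝔤` being a module over
itself by the adjoint representation). -/
structure IsNormalized (ε : b.support → ℤˣ) (φ : Space b ≃ₗ⁅ℂ, Alg b⁆ Alg b) : Prop where
  map_v (i : b.support) : φ (v b i) = ((ε i : ℤ) : ℂ) • eG b i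
  map_v_neg (i : b.support) : φ (v b (negIdx P i)) = -(((ε i : ℤ) : ℂ) • fG b i)
  map_u (i : b.support) : φ (u i) = -(((ε i : ℤ) : ℂ) • hG b i)

/-- The number `m⁻_α(β) = q + 1`, where `β - qα, …, β, …, β + pα` is the `α`-string through `β`. -/
noncomputable def mMinus (P : RootPairing ι ℂ V W) [P.IsCrystallographic] (α β : ι) : ℕ :=
  P.chainBotCoeff α β + 1

/-- The elements `h i` (`i` simple) and `x α` (`α` a root) form a Chevalley basis of `𝔤`: they are
a vector space basis with `x α` in the root space of `α`, satisfying `⁅x α, x (-α)⁆ = h_α`, such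
that for roots `α`, `β`, `α + β` the structure constant `N_{α,β}` is `±m⁻_α(β)` and
`N_{-α,-β} = -N_{α,β}`. -/
structure IsChevalleyBasis (x : ι → Alg b) : Prop where
  linearIndependent : LinearIndependent ℂ (Sum.elim (hG b) x)
  span_eq_top : Submodule.span ℂ (Set.range (Sum.elim (hG b) x)) = ⊤
  lie_h_h (i j : b.support) : ⁅hG b i, hG b j⁆ = 0
  lie_h_x (i : b.support) (α : ι) : ⁅hG b i, x α⁆ = (P.pairingIn ℤ α i : ℂ) • x α
  lie_x_neg (α : ι) : ⁅x α, x (negIdx P α)⁆ = corootG b α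
  lie_x_x (α β γ : ι) (hγ : P.root γ = P.root α + P.root β) :
    ∃ N : ℤ, (N = mMinus P α β ∨ N = -mMinus P α β) ∧
      ⁅x α, x β⁆ = (N : ℂ) • x γ ∧
      ⁅x (negIdx P α), x (negIdx P β)⁆ = ((-N : ℤ) : ℂ) • x (negIdx P γ)
  lie_x_x_eq_zero (α β : ι) (h₀ : P.root α + P.root β ≠ 0)
    (h₁ : P.root α + P.root β ∉ Set.range P.root) : ⁅x α, x β⁆ = 0

/-- The rescaled elements: `x α` if the height of `α` is even, `√-1 · x α` if it is odd. -/
noncomputable def rescale (x : ι → Alg b) (α : ι) : Alg b :=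
  if Even (b.height α) then x α else Complex.I • x α

end

end GeckChevalley

open GeckChevalley

/-! Both `M` and the adjoint module `𝔤` are irreducible, and each contains a highest weight vector
whose weight is a root `θ` of maximal height. The submodule of `M × 𝔤` generated by the pair of
these vectors contains neither vector alone, so it is the graph of an isomorphism
(`exists_equiv_of_graph`, `exists_equiv_of_highestWeight`). Root weight spaces of `M` are lines, so
any isomorphism sends `v_{α_i}` to some `c_i e_i`; evaluating `e_j u_i` in both modules forces `c_j
= -c_i` along edges of the Dynkin diagram (`exists_coeff`). As the diagram is connected, one scalar
turns `c` into `ε`, and irreducibility of `M` gives uniqueness.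

Write `e_α = φ(v_α)`. Relation (a) holds because `-ω̃ φ ω` is again a module morphism and agrees
with `φ` on a `u_i`. For (b), let `κ` be the trace form of `M`; on the `h_α` it is the canonical
form on coroots. With `L_α` the value of that form at `α^∨`, invariance and nondegeneracy reduce (b)
to `2κ(e_α, e_{-α}) = (-1)^{ht α} L_α` (`two_mul_traceForm`). This is proved by adding simple roots
one at a time, using the string identity `p L_β = (q + 1) L_{β+α}`
(`chainTopCoeff_mul_corootLength`).

For (c), the Jacobi identity along the `α`-string gives `[e_{-α}, [e_α, e_β]] = (-1)^{ht α} (q + 1)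
p e_β` (`lie_negIdx_lie`). Invariance of `κ` together with (a) relates the two constants whose
product appears here, and the string identity yields `N² = (q + 1)²` (`lie_map_v`). The factor `√-1`
in odd height then removes the sign in (b). -/

namespace RootPairing

/-! ### Coroot lengths along root strings -/

variable {ι R M N : Type*} [Fintype ι] [CommRing R] [CharZero R] [IsDomain R]
  [AddCommGroup M] [Module R M] [AddCommGroup N] [Module R N]
  (P : RootPairing ι R M N) [P.IsCrystallographic]

/-- The value at a coroot of the quadratic form attached to the canonical form on coroots. -/
noncomputable def corootLength (i : ι) : R := P.CorootForm (P.coroot i) (P.coroot i)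

omit [IsDomain R] in
lemma corootLength_ne_zero (i : ι) : P.corootLength i ≠ 0 :=
  IsAnisotropic.corootForm_coroot_ne_zero i

omit [IsDomain R] in
-- Weyl invariance of the coroot form: both sides are twice its value on the two coroots.
lemma pairingIn_mul_corootLength (i j : ι) :
    (P.pairingIn ℤ i j : R) * P.corootLength i = P.pairingIn ℤ j i * P.corootLength j := by
  have h := P.flip.toInvariantForm.pairing_mul_eq_pairing_mul_swap i j
  have h1 := P.algebraMap_pairingIn ℤ i j
  have h2 := P.algebraMap_pairingIn ℤ j i
  simp only [algebraMap_int_eq, eq_intCast] at h1 h2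
  rw [h1, h2]
  exact h

omit [IsDomain R] in
lemma two_mul_corootForm (i j : ι) :
    2 * P.CorootForm (P.coroot i) (P.coroot j) = P.pairingIn ℤ i j * P.corootLength i := by
  have h := P.flip.toInvariantForm.two_mul_apply_root_root j i
  have h1 := P.algebraMap_pairingIn ℤ i j
  simp only [algebraMap_int_eq, eq_intCast] at h1
  have hs : P.CorootForm (P.coroot j) (P.coroot i) = P.CorootForm (P.coroot i) (P.coroot j) :=
    P.flip.rootForm_symmetric.eq _ _
  rw [h1, ← hs]
  exact h

/-- If `β`, `α` and `γ = β + α` are roots and `β - qα, …, β + pα` is the `α`-string through `β`,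
then `p |γ|² = (q + 1) |β|²`, written in terms of the lengths of coroots. -/
lemma chainTopCoeff_mul_corootLength [P.IsReduced] {α β γ : ι}
    (hγ : P.root γ = P.root β + P.root α) :
    (P.chainTopCoeff α β : R) * P.corootLength β =
      (P.chainBotCoeff α β + 1) * P.corootLength γ := by
  have : Module.IsReflexive R M := .of_isPerfPair P.toLinearMap
  have : IsAddTorsionFree M := .of_isTorsionFree R M
  have hli : LinearIndependent R ![P.root α, P.root β] :=
    P.linearIndependent_of_add_mem_range_root' ⟨γ, by rw [hγ, add_comm]⟩
  have hli' : LinearIndependent R ![P.root α, P.root γ] := by simpa [hγ, add_comm] using hli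
  have key (δ : ι) (hδ : LinearIndependent R ![P.root α, P.root δ]) :
      (P.pairingIn ℤ δ α, P.pairingIn ℤ α δ) ∈
      ({(0, 0), (1, 1), (-1, -1), (1, 2), (2, 1), (-1, -2), (-2, -1), (1, 3), (3, 1), (-1, -3),
        (-3, -1)} : Set (ℤ × ℤ)) := by
    rw [LinearIndependent.pair_symm_iff, IsReduced.linearIndependent_iff] at hδ
    exact P.pairingIn_pairingIn_mem_set_of_isCrystal_of_isRed' _ _
      (fun h => hδ.1 (P.root.injective h)) hδ.2
  have bound (δ : ι) : -3 ≤ P.pairingIn ℤ δ α ∧ P.pairingIn ℤ δ α ≤ 3 := by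
    have := P.pairingIn_pairingIn_mem_set_of_isCrystal_of_isRed δ α
    simp only [Set.mem_insert_iff, Set.mem_singleton_iff, Prod.mk.injEq] at this
    omega
  have hp : 1 ≤ P.chainTopCoeff α β := by
    rw [← P.root_add_nsmul_mem_range_iff_le_chainTopCoeff hli, one_smul]
    exact ⟨γ, hγ⟩
  have hpq := P.chainBotCoeff_sub_chainTopCoeff hli
  have htop : P.pairingIn ℤ (P.chainTopIdx α β) α =
      P.pairingIn ℤ β α + 2 * P.chainTopCoeff α β := by
    rw [P.pairingIn_eq_add_of_root_eq_smul_add_smul (S := ℤ) (k := P.chainTopIdx α β) (j := α)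
      (i := β) (l := α) (x := 1) (y := P.chainTopCoeff α β) (by simp)]
    simp [mul_comm]
  have hbot : P.pairingIn ℤ (P.chainBotIdx α β) α =
      P.pairingIn ℤ β α - 2 * P.chainBotCoeff α β := by
    rw [P.pairingIn_eq_add_of_root_eq_smul_add_smul (S := ℤ) (k := P.chainBotIdx α β) (j := α)
      (i := β) (l := α) (x := 1) (y := -P.chainBotCoeff α β) (by simp [sub_eq_add_neg])]
    simp [mul_comm, sub_eq_add_neg]
  -- The ends of the string are roots, with pairings `p + q` and `-(p + q)` against `α`; hence `p +
  -- q ≤ 3`.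
  have htop' := bound (P.chainTopIdx α β)
  have hbot' := bound (P.chainBotIdx α β)
  rw [htop] at htop'
  rw [hbot] at hbot'
  have h1 := P.pairingIn_mul_corootLength β α
  have h2 := P.pairingIn_mul_corootLength γ α
  have h3 := P.pairingIn_mul_corootLength γ β
  have hγα : P.pairingIn ℤ γ α = P.pairingIn ℤ β α + 2 := by
    rw [P.pairingIn_eq_add_of_root_eq_add hγ]; simp
  have hγβ : P.pairingIn ℤ γ β = 2 + P.pairingIn ℤ α β := by
    rw [P.pairingIn_eq_add_of_root_eq_add hγ]; simp
  have hβγ : P.pairingIn ℤ β γ = 2 - P.pairingIn ℤ α γ := by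
    have := P.pairingIn_eq_add_of_root_eq_add (S := ℤ) (j := γ) hγ
    simp only [pairingIn_same] at this
    omega
  have k1 := key β hli
  have k2 := key γ hli'
  have k3 := P.pairingIn_pairingIn_mem_set_of_isCrystal_of_isRed γ β
  have hα := P.corootLength_ne_zero α
  rw [hγα] at h2 k2
  rw [hγβ, hβγ] at h3 k3
  generalize P.pairingIn ℤ β α = a at *
  generalize P.pairingIn ℤ α β = a' at *
  generalize P.pairingIn ℤ α γ = c at *
  generalize P.chainTopCoeff α β = p at *
  generalize P.chainBotCoeff α β = q at *
  simp only [Set.mem_insert_iff, Set.mem_singleton_iff, Prod.mk.injEq] at k1 k2 k3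
  -- The value `a = q - p` determines `(p, q)` except when `a = -1`, where both `(1, 0)` and `(2,
  -- 1)` occur. In that case `p = q + 1`, and `β` and `γ` have coroots of equal length.
  by_cases ha : a = -1
  · obtain rfl : p = q + 1 := by omega
    subst ha
    push_cast at h1 h2 h3 ⊢
    have h4 : (2 * (c + a') : R) * P.corootLength α = 0 := by
      linear_combination h3 - (2 + a' : R) * h2 - (2 - c : R) * h1
    have h5 : (c + a' : R) = 0 := by simpa [hα] using h4
    linear_combination (q + 1 : R) * (-h2 - h1 - P.corootLength α * h5)
  · have cases : (a = -3 ∧ p = 3 ∧ q = 0) ∨ (a = -2 ∧ p = 2 ∧ q = 0) ∨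
        (a = 0 ∧ p = 1 ∧ q = 1) ∨ (a = 1 ∧ p = 1 ∧ q = 2) := by
      clear k1 k2 k3
      omega
    -- In the remaining cases the finite list of pairing values fixes `a'` and `c`, and `h3` becomes
    -- the claim.
    clear hpq htop htop' hbot hbot' h1 h2 hp
    rcases cases with ⟨rfl, rfl, rfl⟩ | ⟨rfl, rfl, rfl⟩ | ⟨rfl, rfl, rfl⟩ | ⟨rfl, rfl, rfl⟩ <;>
    norm_num at k1 k2
    · obtain rfl := k1
      obtain rfl : c = -1 := by omega
      push_cast at h3 ⊢
      linear_combination -h3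
    · obtain rfl := k1
      obtain rfl := k2
      push_cast at h3 ⊢
      linear_combination -h3
    · obtain rfl := k1
      obtain rfl := k2
      push_cast at h3 ⊢
      linear_combination -h3
    · obtain rfl := k2
      obtain rfl : a' = 1 := by omega
      push_cast at h3 ⊢
      linear_combination -h3

end RootPairing

/-! ### Generators, the involution and weight vectors -/

namespace GeckChevalley

section NegIdx

variable {ι V W : Type*} [AddCommGroup V] [Module ℂ V] [AddCommGroup W] [Module ℂ W]
  (P : RootPairing ι ℂ V W)

lemma eq_negIdx_iff {α β : ι} : α = negIdx P β ↔ P.root α = -P.root β := by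
  rw [← root_negIdx, P.root.injective.eq_iff]

@[simp] lemma negIdx_negIdx (α : ι) : negIdx P (negIdx P α) = α := by
  rw [eq_comm, eq_negIdx_iff, root_negIdx, neg_neg]

lemma height_negIdx (b : P.Base) (α : ι) : b.height (negIdx P α) = -b.height α :=
  b.height_reflectionPerm_self α

end NegIdx

variable {ι V W : Type*} [Fintype ι] [DecidableEq ι]
  [AddCommGroup V] [Module ℂ V] [AddCommGroup W] [Module ℂ W]
  {P : RootPairing ι ℂ V W} [P.IsCrystallographic] (b : P.Base)

omit [Fintype ι] [DecidableEq ι] in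
lemma pairingIn_eq_toLinearMap (α β : ι) :
    (P.pairingIn ℤ α β : ℂ) = P.toLinearMap (P.root α) (P.coroot β) := by
  simpa using P.algebraMap_pairingIn ℤ α β

section Actions

lemma eG_lie_v {i j : ι} {k : b.support} (h : P.root j = P.root k + P.root i) :
    ⁅eG b k, v b i⁆ = (P.chainBotCoeff k i + 1 : ℂ) • v b j :=
  e_lie_v_ne h

lemma fG_lie_v_same (i : b.support) : ⁅fG b i, v b i⁆ = u (R := ℂ) i :=
  f_lie_v_same i

lemma eG_lie_u (i j : b.support) :
    ⁅eG b i, u (R := ℂ) j⁆ = ((|b.cartanMatrix i j| : ℤ) : ℂ) • v b i := by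
  rw [Int.cast_smul_eq_zsmul]
  exact e_lie_u i j

lemma hG_lie_apply_inl (i j : b.support) (m : Space b) : ⁅hG b i, m⁆ (Sum.inl j) = 0 := by
  change (Matrix.mulVec (h i) m) (Sum.inl j) = 0
  rw [h_eq_diagonal, Matrix.mulVec_diagonal]
  simp

lemma hG_lie_apply_inr (i : b.support) (β : ι) (m : Space b) :
    ⁅hG b i, m⁆ (Sum.inr β) = (P.pairingIn ℤ β i : ℂ) * m (Sum.inr β) := by
  change (Matrix.mulVec (h i) m) (Sum.inr β) = _
  rw [h_eq_diagonal, Matrix.mulVec_diagonal]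
  simp

lemma eG_lie_v_neg (i : b.support) : ⁅eG b i, v b (negIdx P i)⁆ = u (R := ℂ) i := by
  change Matrix.mulVec (e i) (v b (negIdx P i)) = u (R := ℂ) i
  ext (j | j)
  · simp [e, Pi.single_apply, negIdx]
  · simp [e, P.ne_zero j, negIdx]

end Actions

section Omega

omit [P.IsCrystallographic] in
lemma ω_mulVec_v (α : ι) : (ω b).mulVec (v b α : Space b) = v b (negIdx P α) := by
  ext (j | j)
  · simp [ω, v]
  · simp [ω, v, Pi.single_apply, negIdx]

omit [P.IsCrystallographic] in
lemma ω_mulVec_u (i : b.support) : (ω b).mulVec (u i : Space b) = u i := by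
  ext (j | j) <;> simp [ω, u, Pi.single_apply, Matrix.one_apply]

lemma omegaG_lie (x : Alg b) (m : Space b) :
    ⁅omegaG b x, (ω b).mulVec m⁆ = (ω b).mulVec ⁅x, m⁆ := by
  change Matrix.mulVec (ω b * x.1 * ω b) ((ω b).mulVec m) = (ω b).mulVec (Matrix.mulVec x.1 m)
  rw [Matrix.mulVec_mulVec, Matrix.mulVec_mulVec, mul_assoc, ω_mul_ω, mul_one]

lemma omegaG_omegaG (x : Alg b) : omegaG b (omegaG b x) = x :=
  (omegaG b).left_inv x

lemma omegaG_eG (i : b.support) : omegaG b (eG b i) = fG b i :=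
  Subtype.ext (show ω b * e i * ω b = f i by rw [ω_mul_e, mul_assoc, ω_mul_ω, mul_one])

lemma omegaG_hG (i : b.support) : omegaG b (hG b i) = -hG b i :=
  Subtype.ext (show ω b * h i * ω b = -h i by rw [ω_mul_h, mul_assoc, ω_mul_ω, mul_one])

end Omega

section Brackets

lemma hG_lie_eG (i j : b.support) : ⁅hG b j, eG b i⁆ = (P.pairingIn ℤ i j : ℂ) • eG b i := by
  rw [Int.cast_smul_eq_zsmul]
  exact Subtype.ext (lie_h_e i j)

lemma hG_lie_fG (i j : b.support) : ⁅hG b j, fG b i⁆ = -(P.pairingIn ℤ i j : ℂ) • fG b i := by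
  rw [← Int.cast_neg, Int.cast_smul_eq_zsmul]
  exact Subtype.ext (lie_h_f i j)

lemma hG_lie_hG (i j : b.support) : ⁅hG b i, hG b j⁆ = 0 :=
  Subtype.ext (lie_h_h i j)

lemma eG_lie_fG_same [P.IsReduced] (i : b.support) : ⁅eG b i, fG b i⁆ = hG b i :=
  Subtype.ext (lie_e_f_same i)

lemma eG_lie_fG_ne [P.IsReduced] [P.IsIrreducible] {i j : b.support} (hij : i ≠ j) :
    ⁅eG b i, fG b j⁆ = 0 :=
  Subtype.ext (lie_e_f_ne hij)

/-- The elements `e i`, `f i`, `h i` generate the Lie algebra. -/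
lemma alg_induction {p : Alg b → Prop} (he : ∀ i, p (eG b i)) (hf : ∀ i, p (fG b i))
    (hh : ∀ i, p (hG b i)) (zero : p 0) (add : ∀ x y, p x → p y → p (x + y))
    (smul : ∀ (t : ℂ) x, p x → p (t • x)) (lie : ∀ x y, p x → p y → p ⁅x, y⁆) (x : Alg b) : p x := by
  obtain ⟨x, hx⟩ := x
  induction hx using LieSubalgebra.lieSpan_induction with
  | mem x hx =>
    rcases hx with (⟨i, rfl⟩ | ⟨i, rfl⟩) | ⟨i, rfl⟩
    exacts [hh i, he i, hf i]
  | zero => exact zero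
  | add x y hx hy h₁ h₂ => exact add _ _ h₁ h₂
  | smul t x hx h => exact smul t _ h
  | lie x y hx hy h₁ h₂ => exact lie _ _ h₁ h₂

end Brackets

section Weights

variable {X : Type*} [AddCommGroup X] [Module ℂ X] [LieRingModule (Alg b) X] [LieModule ℂ (Alg b) X]

/-- `m` lies in the `μ`-weight space of the `𝔤`-module `X`. -/
def IsWeightVector (μ : V) (m : X) : Prop :=
  ∀ i : b.support, ⁅hG b i, m⁆ = P.toLinearMap μ (P.coroot i) • m

variable {b}

omit [LieModule ℂ (Alg b) X] in
lemma IsWeightVector.congr {μ ν : V} {m : X} (hm : IsWeightVector b μ m) (h : μ = ν) :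
    IsWeightVector b ν m := h ▸ hm

lemma IsWeightVector.smul {μ : V} {m : X} (hm : IsWeightVector b μ m) (t : ℂ) :
    IsWeightVector b μ (t • m) := fun i => by
  rw [lie_smul, hm i, smul_comm]

lemma IsWeightVector.lie {μ ν : V} {x : Alg b} {m : X} (hx : IsWeightVector b μ x)
    (hm : IsWeightVector b ν m) : IsWeightVector b (μ + ν) ⁅x, m⁆ := fun i => by
  rw [leibniz_lie, hx i, hm i, smul_lie, lie_smul, map_add, LinearMap.add_apply, add_smul]

omit [LieModule ℂ (Alg b) X] in
lemma IsWeightVector.map {Y : Type*} [AddCommGroup Y] [Module ℂ Y] [LieRingModule (Alg b) Y]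
    [LieModule ℂ (Alg b) Y] {μ : V} {m : X} (hm : IsWeightVector b μ m) (φ : X →ₗ⁅ℂ, Alg b⁆ Y) :
    IsWeightVector b μ (φ m) := fun i => by
  rw [← LieModuleHom.map_lie, hm i, map_smul]

variable (b)

lemma isWeightVector_eG (i : b.support) : IsWeightVector b (P.root i) (eG b i) := fun j => by
  rw [hG_lie_eG, pairingIn_eq_toLinearMap]

lemma isWeightVector_fG (i : b.support) : IsWeightVector b (-P.root i) (fG b i) := fun j => by
  rw [hG_lie_fG, pairingIn_eq_toLinearMap, map_neg, LinearMap.neg_apply]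

lemma isWeightVector_v (α : ι) : IsWeightVector b (P.root α) (v b α : Space b) := fun j => by
  rw [← pairingIn_eq_toLinearMap]
  ext (k | k)
  · simp [hG_lie_apply_inl]
  · rw [hG_lie_apply_inr]
    by_cases hk : k = α
    · simp [hk]
    · simp [hk]

omit [Fintype ι] [DecidableEq ι] [P.IsCrystallographic] in
/-- A weight is determined by its values on the simple coroots. -/
lemma weight_ext [P.IsRootSystem] {μ ν : V}
    (h : ∀ i : b.support, P.toLinearMap μ (P.coroot i) = P.toLinearMap ν (P.coroot i)) :
    μ = ν := by
  apply P.toPerfPair.injective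
  apply LinearMap.ext_on (s := P.coroot '' b.support)
  · rw [b.span_coroot_support]
    exact IsRootSystem.span_coroot_eq_top
  · rintro _ ⟨i, hi, rfl⟩
    exact h ⟨i, hi⟩

variable {b} [P.IsRootSystem]

lemma IsWeightVector.apply_inr {μ : V} {m : Space b} (hm : IsWeightVector b μ m) {β : ι}
    (hβ : P.root β ≠ μ) : m (Sum.inr β) = 0 := by
  by_contra h0
  refine hβ (weight_ext b fun i => ?_)
  have := congrFun (hm i) (Sum.inr β)
  rw [hG_lie_apply_inr, Pi.smul_apply, smul_eq_mul, pairingIn_eq_toLinearMap] at this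
  exact mul_right_cancel₀ h0 this

lemma IsWeightVector.apply_inl {μ : V} {m : Space b} (hm : IsWeightVector b μ m) (hμ : μ ≠ 0)
    (j : b.support) : m (Sum.inl j) = 0 := by
  by_contra h0
  refine hμ (weight_ext b fun i => ?_)
  have := congrFun (hm i) (Sum.inl j)
  rw [hG_lie_apply_inl, Pi.smul_apply, smul_eq_mul] at this
  rw [map_zero, LinearMap.zero_apply]
  exact (mul_eq_zero.mp this.symm).resolve_right h0

lemma IsWeightVector.eq_zero {μ : V} {m : Space b} (hm : IsWeightVector b μ m) (hμ : μ ≠ 0)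
    (hμ' : μ ∉ Set.range P.root) : m = 0 := by
  ext (j | j)
  · exact hm.apply_inl hμ j
  · exact hm.apply_inr fun h => hμ' ⟨j, h⟩

/-- The root weight spaces of `M` are lines; transported through `φ`, this gives the same for `𝔤` in
explicit form. -/
lemma IsWeightVector.eq_smul_v {γ : ι} {m : Space b} (hm : IsWeightVector b (P.root γ) m) :
    m = m (Sum.inr γ) • v b γ := by
  ext (j | j)
  · simp [hm.apply_inl (P.ne_zero γ) j]
  · by_cases hj : j = γ
    · simp [hj]
    · simp [hj, hm.apply_inr fun h => hj (P.root.injective h)]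

lemma IsWeightVector.eq_sum_u {m : Space b} (hm : IsWeightVector b (0 : V) m) :
    m = ∑ i : b.support, m (Sum.inl i) • u (R := ℂ) i := by
  ext (j | j)
  · simp [Finset.sum_apply, Pi.single_apply]
  · simp [Finset.sum_apply, hm.apply_inr (P.ne_zero j)]

end Weights

end GeckChevalley

/-! ### Simplicity and root spaces of the Lie algebra -/

namespace RootPairing

/-- The weight equivalence intertwines the reflections, so an invariant subspace for `Q` pulls back
to one for `P`. -/
lemma Equiv.isIrreducible {ι₁ ι₂ K M₁ N₁ M₂ N₂ : Type*} [Field K]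
    [AddCommGroup M₁] [Module K M₁] [AddCommGroup N₁] [Module K N₁]
    [AddCommGroup M₂] [Module K M₂] [AddCommGroup N₂] [Module K N₂]
    {P : RootPairing ι₁ K M₁ N₁} {Q : RootPairing ι₂ K M₂ N₂} [P.IsIrreducible]
    (e : P.Equiv Q) : Q.IsIrreducible := by
  have : Nontrivial M₁ := IsIrreducible.nontrivial P
  have : Nontrivial M₂ := (Equiv.weightEquiv P Q e).injective.nontrivial
  refine IsIrreducible.mk' Q fun q hq hq₀ => ?_
  let f := Equiv.weightEquiv P Q e
  have hf (i : ι₁) (m : M₁) : f (P.reflection i m) = Q.reflection (e.indexEquiv i) (f m) := by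
    have h1 : f (P.root i) = Q.root (e.indexEquiv i) := Hom.root_weightMap_apply P Q i e.toHom
    have h2 : Q.coroot' (e.indexEquiv i) (f m) = P.coroot' i m := by
      have := Hom.weight_coweight_transpose_apply P Q (Q.coroot (e.indexEquiv i)) e.toHom
      rw [Hom.coroot_coweightMap_apply, Equiv.symm_apply_apply] at this
      exact LinearMap.congr_fun this m
    rw [reflection_apply, reflection_apply, map_sub, map_smul, h1, h2]
  have h : q.comap f.toLinearMap = ⊤ := by
    refine IsIrreducible.eq_top_of_invtSubmodule_reflection (P := P) _ (fun i m hm => ?_) ?_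
    · change f (P.reflection i m) ∈ q
      rw [hf]
      exact hq _ hm
    · contrapose! hq₀
      rw [eq_bot_iff]
      intro m hm
      have : f.symm m ∈ q.comap f.toLinearMap := by simpa using hm
      rw [hq₀] at this
      simpa using this
  rw [eq_top_iff]
  intro m _
  have : f.symm m ∈ q.comap f.toLinearMap := h ▸ Submodule.mem_top
  simpa using this

end RootPairing

namespace GeckChevalley

open LieAlgebra LieAlgebra.IsKilling LieModule

variable {ι V W : Type*} [Fintype ι] [DecidableEq ι]
  [AddCommGroup V] [Module ℂ V] [AddCommGroup W] [Module ℂ W]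
  {P : RootPairing ι ℂ V W} [P.IsCrystallographic] [P.IsRootSystem] [P.IsReduced] [P.IsIrreducible]
  (b : P.Base)

/-- Simplicity is needed because it makes the adjoint module irreducible. -/
instance : LieAlgebra.IsSimple ℂ (Alg b) := by
  have : (rootSystem (cartanSubalgebra' b)).IsIrreducible :=
    (equivRootSystem b).isIrreducible
  exact (isSimple_iff_isIrreducible (H := cartanSubalgebra' b)).mp this

/-- The identification of the weight space of `P` with the dual of the Cartan subalgebra. -/
noncomputable def weightDual : V ≃ₗ[ℂ] Module.Dual ℂ (cartanSubalgebra' b) :=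
  Equiv.weightEquiv _ _ (equivRootSystem b)

lemma weightDual_root (α : ι) : weightDual b (P.root α) =
    (rootSystem (cartanSubalgebra' b)).root ((equivRootSystem b).indexEquiv α) :=
  Hom.root_weightMap_apply _ _ α (equivRootSystem b).toHom

lemma weightDual_apply (μ : V) (i : b.support) :
    weightDual b μ (h' i) = P.toLinearMap μ (P.coroot i) := by
  let f₁ : V →ₗ[ℂ] ℂ := (LinearMap.applyₗ (h' i)) ∘ₗ (weightDual b).toLinearMap
  let f₂ : V →ₗ[ℂ] ℂ := P.toLinearMap.flip (P.coroot i)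
  suffices f₁ = f₂ from LinearMap.congr_fun this μ
  refine b.toWeightBasis.ext fun j => ?_
  have h1 : weightDual b (b.toWeightBasis j) = (basis b).baseSupp j := by
    -- On weights, `equivRootSystem b` is the linear map matching the two bases of simple roots; the
    -- claim therefore reduces to equality of Cartan matrices.
    change b.toWeightBasis.equiv (basis b).base.toWeightBasis (basis b).baseSupportEquiv
      (b.toWeightBasis j) = _
    rw [Module.Basis.equiv_apply, Base.toWeightBasis_apply]
    rfl
  have h2 := (basis b).baseSupp_apply_h' j i
  change weightDual b (b.toWeightBasis j) (h' i) = P.toLinearMap (b.toWeightBasis j) (P.coroot i)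
  rw [h1, Base.toWeightBasis_apply, ← pairingIn_eq_toLinearMap]
  exact h2

lemma isWeightVector_iff_mem_rootSpace {μ : V} {x : Alg b} :
    IsWeightVector b μ x ↔ x ∈ rootSpace (cartanSubalgebra' b) (weightDual b μ) := by
  constructor
  · intro hx
    have key (h : cartanSubalgebra' b) : ⁅h, x⁆ = weightDual b μ h • x := by
      have hh : h ∈ Submodule.span ℂ (Set.range (h' (b := b))) := by
        rw [span_range_h'_eq_top]; trivial
      induction hh using Submodule.span_induction with
      | mem h hh =>
        obtain ⟨i, rfl⟩ := hh
        rw [weightDual_apply]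
        exact hx i
      | zero => simp
      | add y z _ _ hy hz => rw [add_lie, hy, hz, map_add, add_smul]
      | smul t y _ hy => rw [smul_lie, hy, map_smul, smul_assoc]
    refine (mem_genWeightSpace _ _ _).mpr fun h => ⟨1, ?_⟩
    simp [key]
  · intro hx i
    have := lie_eq_smul_of_mem_rootSpace hx (h' i)
    rw [weightDual_apply] at this
    exact this

lemma exists_isWeightVector_root (α : ι) : ∃ x : Alg b, x ≠ 0 ∧ IsWeightVector b (P.root α) x := by
  let χ := (equivRootSystem b).indexEquiv α
  obtain ⟨x, hx, hx₀⟩ := χ.1.exists_ne_zero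
  refine ⟨x, hx₀, ?_⟩
  rw [isWeightVector_iff_mem_rootSpace, weightDual_root]
  exact hx

lemma mem_range_root_of_isWeightVector {μ : V} (hμ : μ ≠ 0) {x : Alg b} (hx₀ : x ≠ 0)
    (hx : IsWeightVector b μ x) : μ ∈ Set.range P.root := by
  rw [isWeightVector_iff_mem_rootSpace] at hx
  let χ : Weight ℂ (cartanSubalgebra' b) (Alg b) :=
    ⟨weightDual b μ, fun h => hx₀ (by simpa [h] using hx)⟩
  have hχ : χ.IsNonZero := fun h => hμ <| (weightDual b).injective <| by
    rw [map_zero]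
    exact LinearMap.coe_injective h
  let χ' : (cartanSubalgebra' b).root := ⟨χ, by simpa using hχ⟩
  refine ⟨(equivRootSystem b).indexEquiv.symm χ', (weightDual b).injective ?_⟩
  rw [weightDual_root, Equiv.apply_symm_apply]
  exact LinearMap.coe_injective rfl

end GeckChevalley

/-! ### Products of Lie modules and graphs of isomorphisms -/

section LieModuleProd

variable {R L X Y : Type*} [CommRing R] [LieRing L] [LieAlgebra R L]
  [AddCommGroup X] [Module R X] [LieRingModule L X] [LieModule R L X]
  [AddCommGroup Y] [Module R Y] [LieRingModule L Y] [LieModule R L Y]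

/-- The diagonal action on a product of two modules over a Lie ring. -/
instance prodLieRingModule : LieRingModule L (X × Y) where
  bracket x m := (⁅x, m.1⁆, ⁅x, m.2⁆)
  add_lie x y m := Prod.ext (add_lie x y m.1) (add_lie x y m.2)
  lie_add x m n := Prod.ext (lie_add x m.1 n.1) (lie_add x m.2 n.2)
  leibniz_lie x y m := Prod.ext (leibniz_lie x y m.1) (leibniz_lie x y m.2)

omit [CommRing R] [LieAlgebra R L] [Module R X] [LieModule R L X] [Module R Y] [LieModule R L Y] in
lemma lie_prod_mk (x : L) (m : X) (n : Y) : ⁅x, (m, n)⁆ = (⁅x, m⁆, ⁅x, n⁆) := rfl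

instance prodLieModule : LieModule R L (X × Y) where
  smul_lie t x m := Prod.ext (smul_lie t x m.1) (smul_lie t x m.2)
  lie_smul t x m := Prod.ext (lie_smul t x m.1) (lie_smul t x m.2)

variable (R L X Y)

/-- The first projection as a morphism of Lie modules. -/
def LieModuleHom.prodFst : X × Y →ₗ⁅R, L⁆ X :=
  { LinearMap.fst R X Y with map_lie' := rfl }

/-- The second projection as a morphism of Lie modules. -/
def LieModuleHom.prodSnd : X × Y →ₗ⁅R, L⁆ Y :=
  { LinearMap.snd R X Y with map_lie' := rfl }

/-- The first inclusion as a morphism of Lie modules. -/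
def LieModuleHom.prodInl : X →ₗ⁅R, L⁆ X × Y :=
  { LinearMap.inl R X Y with map_lie' := fun {x m} => by simp [lie_prod_mk] }

/-- The second inclusion as a morphism of Lie modules. -/
def LieModuleHom.prodInr : Y →ₗ⁅R, L⁆ X × Y :=
  { LinearMap.inr R X Y with map_lie' := fun {x m} => by simp [lie_prod_mk] }

variable {R L X Y}

/-- A bijective morphism of Lie modules as an equivalence. -/
noncomputable def LieModuleHom.equivOfBijective (φ : X →ₗ⁅R, L⁆ Y) (hφ : Function.Bijective φ) :
    X ≃ₗ⁅R, L⁆ Y :=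
  { φ, LinearEquiv.ofBijective φ.toLinearMap hφ with }

/-- If a submodule of a product of two irreducible Lie modules contains neither factor
and is non-trivial, then it is the graph of an equivalence. -/
lemma exists_equiv_of_graph [LieModule.IsIrreducible R L X] [LieModule.IsIrreducible R L Y]
    (K : LieSubmodule R L (X × Y)) (hX : ∃ m : X, (m, (0 : Y)) ∉ K) (hY : ∃ n : Y, ((0 : X), n) ∉ K)
    (hK : K ≠ ⊥) : ∃ φ : X ≃ₗ⁅R, L⁆ Y, ∀ z ∈ K, φ z.1 = z.2 := by
  have hX' : K.comap (LieModuleHom.prodInl R L X Y) = ⊥ := by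
    obtain ⟨m, hm⟩ := hX
    refine (eq_bot_or_eq_top _).resolve_right fun h => hm ?_
    have : m ∈ K.comap (LieModuleHom.prodInl R L X Y) := h ▸ LieSubmodule.mem_top m
    exact this
  have hY' : K.comap (LieModuleHom.prodInr R L X Y) = ⊥ := by
    obtain ⟨m, hm⟩ := hY
    refine (eq_bot_or_eq_top _).resolve_right fun h => hm ?_
    have : m ∈ K.comap (LieModuleHom.prodInr R L X Y) := h ▸ LieSubmodule.mem_top m
    exact this
  have hX0 (m : X) (hm : (m, (0 : Y)) ∈ K) : m = 0 := by
    have : m ∈ K.comap (LieModuleHom.prodInl R L X Y) := hm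
    simpa [hX'] using this
  have hY0 (n : Y) (hn : ((0 : X), n) ∈ K) : n = 0 := by
    have : n ∈ K.comap (LieModuleHom.prodInr R L X Y) := hn
    simpa [hY'] using this
  obtain ⟨z, hz, hz0⟩ := K.toSubmodule.ne_bot_iff.mp (by simpa using hK)
  let f := (LieModuleHom.prodFst R L X Y).comp K.incl
  let g := (LieModuleHom.prodSnd R L X Y).comp K.incl
  -- The kernel of each projection of `K` is its intersection with the other factor, which is zero.
  -- Its image is nonzero for the same reason, hence everything by irreducibility.
  have hf : Function.Bijective f := by
    constructor
    · rw [← LieModuleHom.ker_eq_bot, LieSubmodule.eq_bot_iff]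
      rintro ⟨⟨m, n⟩, hmn⟩ h
      obtain rfl : m = 0 := h
      obtain rfl := hY0 n hmn
      rfl
    · rw [← LieModuleHom.range_eq_top]
      refine (eq_bot_or_eq_top _).resolve_left fun h => hz0 ?_
      have h1 : f ⟨z, hz⟩ ∈ f.range := ⟨_, rfl⟩
      rw [h, LieSubmodule.mem_bot] at h1
      have h2 : z = (0, z.2) := Prod.ext h1 rfl
      rw [h2] at hz
      rw [h2, hY0 _ hz]; rfl
  have hg : Function.Bijective g := by
    constructor
    · rw [← LieModuleHom.ker_eq_bot, LieSubmodule.eq_bot_iff]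
      rintro ⟨⟨m, n⟩, hmn⟩ h
      obtain rfl : n = 0 := h
      obtain rfl := hX0 m hmn
      rfl
    · rw [← LieModuleHom.range_eq_top]
      refine (eq_bot_or_eq_top _).resolve_left fun h => hz0 ?_
      have h1 : g ⟨z, hz⟩ ∈ g.range := ⟨_, rfl⟩
      rw [h, LieSubmodule.mem_bot] at h1
      have h2 : z = (z.1, 0) := Prod.ext rfl h1
      rw [h2] at hz
      rw [h2, hX0 _ hz]; rfl
  refine ⟨(f.equivOfBijective hf).symm.trans (g.equivOfBijective hg), fun z hz => ?_⟩
  have : (f.equivOfBijective hf).symm z.1 = ⟨z, hz⟩ :=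
    (LinearEquiv.symm_apply_eq (LinearEquiv.ofBijective f.toLinearMap hf)).mpr rfl
  rw [LieModuleEquiv.trans_apply, this]
  rfl

end LieModuleProd

/-! ### Submodules generated by highest weight vectors -/

namespace GeckChevalley

variable {ι V W : Type*} [Fintype ι] [DecidableEq ι]
  [AddCommGroup V] [Module ℂ V] [AddCommGroup W] [Module ℂ W]
  {P : RootPairing ι ℂ V W} [P.IsCrystallographic] [P.IsRootSystem] [P.IsReduced]
  (b : P.Base)

omit [Fintype ι] [DecidableEq ι] [P.IsCrystallographic] [P.IsReduced] in
/-- There is a linear combination of the simple coroots on which all simple roots take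
the value `1`. -/
lemma exists_sum_coroot :
    ∃ c : b.support → ℂ, ∀ j : b.support, P.toLinearMap (P.root j) (∑ i, c i • P.coroot i) = 1 := by
  -- The functional equal to `1` on every simple root is represented by an element of `W` through
  -- the perfect pairing.
  let f : V →ₗ[ℂ] ℂ := b.toWeightBasis.constr ℂ fun _ => (1 : ℂ)
  let w : W := P.flip.toPerfPair.symm f
  refine ⟨fun i => b.toCoweightBasis.repr w i, fun j => ?_⟩
  have h1 : ∑ i, b.toCoweightBasis.repr w i • P.coroot i = w := by
    conv_rhs => rw [← b.toCoweightBasis.sum_repr w]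
    simp
  have h2 : P.toLinearMap (P.root j) w = f (P.root j) :=
    LinearMap.congr_fun (P.flip.toPerfPair.apply_symm_apply f) (P.root j)
  rw [h1, h2, ← b.toWeightBasis_apply, Module.Basis.constr_basis]

section HighestWeight

variable {X : Type*} [AddCommGroup X] [Module ℂ X] [LieRingModule (Alg b) X] [LieModule ℂ (Alg b) X]

/-- The result of applying a sequence of operators `f i` to a vector of a `𝔤`-module. -/
noncomputable def lowering (w : X) (l : List b.support) : X :=
  l.foldr (fun i m => ⁅fG b i, m⁆) w

omit [P.IsRootSystem] [P.IsReduced] [Module ℂ X] [LieModule ℂ (Alg b) X] in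
lemma lowering_cons (w : X) (i : b.support) (l : List b.support) :
    lowering b w (i :: l) = ⁅fG b i, lowering b w l⁆ := rfl

omit [P.IsRootSystem] [P.IsReduced] in
lemma isWeightVector_lowering {w : X} {μ : V} (hw : IsWeightVector b μ w) (l : List b.support) :
    IsWeightVector b (μ - (l.map fun i : b.support => P.root i).sum) (lowering b w l) := by
  induction l with
  | nil => simpa [lowering] using hw
  | cons i l ih =>
    rw [lowering_cons]
    refine ((isWeightVector_fG b i).lie ih).congr ?_
    rw [List.map_cons, List.sum_cons]
    abel

variable [P.IsIrreducible]

omit [P.IsRootSystem] in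
/-- The submodule generated by a highest weight vector. -/
noncomputable def highestWeightSubmodule {w : X} {μ : V} (hw : IsWeightVector b μ w)
    (he : ∀ i, ⁅eG b i, w⁆ = 0) : LieSubmodule ℂ (Alg b) X where
  __ := Submodule.span ℂ (Set.range (lowering b w))
  lie_mem {x m} hm := by
    let K := Submodule.span ℂ (Set.range (lowering b w))
    have hl (l : List b.support) : lowering b w l ∈ K := Submodule.subset_span ⟨l, rfl⟩
    have hH (i : b.support) (l : List b.support) : ⁅hG b i, lowering b w l⁆ ∈ K := by
      rw [isWeightVector_lowering b hw l i]
      exact K.smul_mem _ (hl l)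
    have of_lowering (x : Alg b) (hx : ∀ l, ⁅x, lowering b w l⁆ ∈ K) (m : X) (hm : m ∈ K) :
        ⁅x, m⁆ ∈ K := by
      induction hm using Submodule.span_induction with
      | mem m hm =>
        obtain ⟨l, rfl⟩ := hm
        exact hx l
      | zero => simp
      | add m n _ _ hm hn => rw [lie_add]; exact K.add_mem hm hn
      | smul t m _ hm => rw [lie_smul]; exact K.smul_mem t hm
    have hF (i : b.support) : ∀ m ∈ K, ⁅fG b i, m⁆ ∈ K :=
      of_lowering _ fun l => hl (i :: l)
    have hE (i : b.support) (l : List b.support) : ⁅eG b i, lowering b w l⁆ ∈ K := by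
      induction l with
      | nil => simp [lowering, he i]
      | cons j l ih =>
        -- Moving `e_i` past `f_j` costs `[e_i, f_j]`, which is `h_i` or zero, and words are
        -- eigenvectors of `h_i`.
        rw [lowering_cons, leibniz_lie]
        refine K.add_mem ?_ (hF j _ ih)
        by_cases hij : i = j
        · subst hij
          rw [eG_lie_fG_same]
          exact hH i l
        · rw [eG_lie_fG_ne b hij]
          simp
    suffices ∀ (x : Alg b), ∀ m ∈ K, ⁅x, m⁆ ∈ K from this x m hm
    intro x
    induction x using alg_induction with
    | he i => exact of_lowering _ (hE i)
    | hf i => exact hF i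
    | hh i => exact of_lowering _ (hH i)
    | zero => simp
    | add x y hx hy => intro m hm; rw [add_lie]; exact K.add_mem (hx m hm) (hy m hm)
    | smul t x hx => intro m hm; rw [smul_lie]; exact K.smul_mem t (hx m hm)
    | lie x y hx hy =>
      intro m hm
      rw [lie_lie]
      exact K.sub_mem (hx _ (hy m hm)) (hy _ (hx m hm))

omit [P.IsRootSystem] in
lemma self_mem_highestWeightSubmodule {w : X} {μ : V} (hw : IsWeightVector b μ w)
    (he : ∀ i, ⁅eG b i, w⁆ = 0) : w ∈ highestWeightSubmodule b hw he :=
  Submodule.subset_span ⟨[], rfl⟩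

/-- The highest weight space of a highest weight module is one-dimensional. -/
lemma eq_smul_of_mem_highestWeightSubmodule {w : X} {μ : V} (hw : IsWeightVector b μ w)
    (he : ∀ i, ⁅eG b i, w⁆ = 0) {z : X} (hz : z ∈ highestWeightSubmodule b hw he)
    (hzμ : IsWeightVector b μ z) : ∃ c : ℂ, z = c • w := by
  obtain ⟨c, hc⟩ := exists_sum_coroot b
  let ρ : V →ₗ[ℂ] ℂ := P.toLinearMap.flip (∑ i, c i • P.coroot i)
  -- A word of length `n` in the `f_i` applied to `w` is an eigenvector of `T` with eigenvalue `ρ(μ)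
  -- - n`, so only the empty word contributes to eigenvalue `ρ(μ)`.
  let T : Module.End ℂ X := LieModule.toEnd ℂ (Alg b) X (∑ i, c i • hG b i)
  have hT {ν : V} {m : X} (hm : IsWeightVector b ν m) : m ∈ T.eigenspace (ρ ν) := by
    rw [Module.End.mem_eigenspace_iff]
    change ⁅∑ i, c i • hG b i, m⁆ = P.toLinearMap ν (∑ i, c i • P.coroot i) • m
    rw [sum_lie, map_sum, Finset.sum_smul]
    exact Finset.sum_congr rfl fun i _ => by rw [smul_lie, hm i, smul_smul, map_smul, smul_eq_mul]
  have hρ (l : List b.support) : ρ (l.map fun i : b.support => P.root i).sum = l.length := by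
    induction l with
    | nil => simp
    | cons i l ih =>
      rw [List.map_cons, List.sum_cons, map_add, ih, List.length_cons]
      have : ρ (P.root i) = 1 := hc i
      rw [this]; push_cast; ring
  have key : ∃ (t : ℂ) (y : X), y ∈ ⨆ ν, ⨆ (_ : ν ≠ ρ μ), T.eigenspace ν ∧ z = t • w + y := by
    have hz' : z ∈ Submodule.span ℂ (Set.range (lowering b w)) := hz
    clear hz hzμ
    induction hz' using Submodule.span_induction with
    | mem z hz =>
      obtain ⟨l, rfl⟩ := hz
      cases l with
      | nil => exact ⟨1, 0, by simp, by simp [lowering]⟩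
      | cons i l =>
        refine ⟨0, lowering b w (i :: l), ?_, by simp⟩
        refine Submodule.mem_iSup_of_mem _ (Submodule.mem_iSup_of_mem ?_
          (hT (isWeightVector_lowering b hw (i :: l))))
        rw [map_sub, hρ]
        intro h
        rw [sub_eq_self] at h
        simp at h
        norm_cast at h
    | zero => exact ⟨0, 0, by simp, by simp⟩
    | add z₁ z₂ _ _ h₁ h₂ =>
      obtain ⟨t₁, y₁, hy₁, rfl⟩ := h₁
      obtain ⟨t₂, y₂, hy₂, rfl⟩ := h₂
      exact ⟨t₁ + t₂, y₁ + y₂, Submodule.add_mem _ hy₁ hy₂, by rw [add_smul]; abel⟩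
    | smul t z _ h =>
      obtain ⟨t₁, y₁, hy₁, rfl⟩ := h
      exact ⟨t * t₁, t • y₁, Submodule.smul_mem _ t hy₁, by rw [smul_add, smul_smul]⟩
  obtain ⟨t, y, hy, rfl⟩ := key
  have hy' : y ∈ T.eigenspace (ρ μ) := by
    have := Submodule.sub_mem _ (hT hzμ) (Submodule.smul_mem _ t (hT hw))
    simpa using this
  have h0 : y = 0 :=
    Submodule.disjoint_def.mp (T.eigenspaces_iSupIndep (ρ μ)) y hy' hy
  exact ⟨t, by simp [h0]⟩

/-- Two irreducible modules with highest weight vectors of the same weight are isomorphic. -/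
lemma exists_equiv_of_highestWeight {Y : Type*} [AddCommGroup Y] [Module ℂ Y]
    [LieRingModule (Alg b) Y] [LieModule ℂ (Alg b) Y] [LieModule.IsIrreducible ℂ (Alg b) X]
    [LieModule.IsIrreducible ℂ (Alg b) Y] {μ : V} {x : X} {y : Y} (hx₀ : x ≠ 0) (hy₀ : y ≠ 0)
    (hx : IsWeightVector b μ x) (hy : IsWeightVector b μ y) (hex : ∀ i, ⁅eG b i, x⁆ = 0)
    (hey : ∀ i, ⁅eG b i, y⁆ = 0) : Nonempty (X ≃ₗ⁅ℂ, Alg b⁆ Y) := by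
  have hw : IsWeightVector b μ (x, y) := fun i => by
    rw [lie_prod_mk, hx i, hy i]; rfl
  have he (i : b.support) : ⁅eG b i, (x, y)⁆ = 0 := by
    rw [lie_prod_mk, hex i, hey i]; rfl
  have hK := self_mem_highestWeightSubmodule b hw he
  -- If `(x, 0)` or `(0, y)` were in the submodule, it would be a multiple of `(x, y)`, having
  -- weight `μ`; this is impossible as `x` and `y` are nonzero.
  obtain ⟨φ, -⟩ := exists_equiv_of_graph (highestWeightSubmodule b hw he)
    ⟨x, fun h => by
      obtain ⟨c, hc⟩ := eq_smul_of_mem_highestWeightSubmodule b hw he h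
        (hx.map (LieModuleHom.prodInl ℂ (Alg b) X Y))
      rw [Prod.smul_mk, Prod.mk.injEq] at hc
      have : c = 0 := (smul_eq_zero.mp hc.2.symm).resolve_right hy₀
      exact hx₀ (by rw [hc.1, this, zero_smul])⟩
    ⟨y, fun h => by
      obtain ⟨c, hc⟩ := eq_smul_of_mem_highestWeightSubmodule b hw he h
        (hy.map (LieModuleHom.prodInr ℂ (Alg b) X Y))
      rw [Prod.smul_mk, Prod.mk.injEq] at hc
      have : c = 0 := (smul_eq_zero.mp hc.1.symm).resolve_right hx₀
      exact hy₀ (by rw [hc.2, this, zero_smul])⟩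
    fun h => hx₀ (by
      rw [h, LieSubmodule.mem_bot] at hK
      exact congrArg Prod.fst hK)
  exact ⟨φ⟩

end HighestWeight

end GeckChevalley

/-! ### The normalised isomorphism: existence and uniqueness -/

namespace GeckChevalley

variable {ι V W : Type*} [Fintype ι] [DecidableEq ι]
  [AddCommGroup V] [Module ℂ V] [AddCommGroup W] [Module ℂ W]
  {P : RootPairing ι ℂ V W} [P.IsCrystallographic] [P.IsRootSystem] [P.IsReduced] [P.IsIrreducible]
  (b : P.Base)

omit [Fintype ι] [DecidableEq ι] in
lemma nonempty_index (P : RootPairing ι ℂ V W) [P.IsRootSystem] [P.IsIrreducible] :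
    Nonempty ι := by
  have : Nontrivial V := IsIrreducible.nontrivial P
  by_contra h
  rw [not_nonempty_iff] at h
  have h1 : Submodule.span ℂ (Set.range P.root) = ⊤ := IsRootSystem.span_root_eq_top
  rw [Set.range_eq_empty, Submodule.span_empty] at h1
  exact bot_ne_top h1

lemma exists_equiv : Nonempty (Space b ≃ₗ⁅ℂ, Alg b⁆ Alg b) := by
  have : Nonempty ι := nonempty_index P
  obtain ⟨θ, hθ⟩ := Finite.exists_max b.height
  obtain ⟨x, hx₀, hx⟩ := exists_isWeightVector_root b θ
  -- Otherwise `-θ` would be simple, of height `1`, exceeding the height `-1` of `θ`.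
  have h0 (i : b.support) : P.root i + P.root θ ≠ 0 := by
    intro h
    have h1 : b.height (negIdx P θ) = 1 := by
      rw [← b.height_one_of_mem_support i.2, ← (eq_negIdx_iff P).mpr (eq_neg_of_add_eq_zero_left h)]
    have h2 := hθ (negIdx P θ)
    rw [height_negIdx] at h1 h2
    omega
  have h1 (i : b.support) : P.root i + P.root θ ∉ Set.range P.root := by
    rintro ⟨γ, hγ⟩
    have h2 := hθ γ
    rw [b.height_add hγ, b.height_one_of_mem_support i.2] at h2
    omega
  refine exists_equiv_of_highestWeight b (x := (v b θ : Space b)) (y := x) (by simp) hx₀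
    (isWeightVector_v b θ) hx (fun i => ?_) fun i => ?_
  · exact ((isWeightVector_eG b i).lie (isWeightVector_v b θ)).eq_zero (h0 i) (h1 i)
  · by_contra h
    exact h1 i (mem_range_root_of_isWeightVector b (h0 i) h ((isWeightVector_eG b i).lie hx))

variable {b}

omit [P.IsReduced] [P.IsIrreducible] in
lemma exists_map_v_eq_smul (φ : Space b ≃ₗ⁅ℂ, Alg b⁆ Alg b) {γ : ι} {x : Alg b} (hx₀ : x ≠ 0)
    (hx : IsWeightVector b (P.root γ) x) : ∃ c : ℂ, c ≠ 0 ∧ φ (v b γ) = c • x := by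
  obtain ⟨t, ht⟩ : ∃ t : ℂ, φ.symm x = t • v b γ :=
    ⟨_, (hx.map φ.symm.toLieModuleHom).eq_smul_v⟩
  have h1 : x = t • φ (v b γ) := by
    rw [show t • φ (v b γ) = φ (t • v b γ) from (map_smul φ.toLieModuleHom _ _).symm, ← ht]
    exact (φ.apply_symm_apply x).symm
  have ht0 : t ≠ 0 := by
    rintro rfl
    exact hx₀ (by rw [h1, zero_smul])
  exact ⟨t⁻¹, inv_ne_zero ht0, by rw [h1, smul_smul, inv_mul_cancel₀ ht0, one_smul]⟩

omit [P.IsRootSystem] [P.IsIrreducible] in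
lemma eG_ne_zero (i : b.support) : eG b i ≠ 0 := fun h =>
  (isSl2Triple i).e_ne_zero (congrArg Subtype.val h)

omit [P.IsRootSystem] [P.IsIrreducible] in
lemma fG_ne_zero (i : b.support) : fG b i ≠ 0 := fun h =>
  (isSl2Triple i).f_ne_zero (congrArg Subtype.val h)

omit [P.IsRootSystem] [P.IsIrreducible] in
lemma hG_ne_zero (i : b.support) : hG b i ≠ 0 := fun h =>
  (isSl2Triple i).h_ne_zero (congrArg Subtype.val h)

omit [P.IsIrreducible] in
/-- Every equivalence `M ≃ 𝔤` maps the generators to multiples of generators, and the multiples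
alternate in sign along the Dynkin diagram. -/
lemma exists_coeff (φ : Space b ≃ₗ⁅ℂ, Alg b⁆ Alg b) : ∃ c : b.support → ℂ, (∀ i, c i ≠ 0) ∧
    (∀ i : b.support, φ (v b i) = c i • eG b i) ∧
    (∀ i : b.support, φ (v b (negIdx P i)) = -(c i • fG b i)) ∧
    (∀ i, φ (u i) = -(c i • hG b i)) ∧
    ∀ i j : b.support, i ≠ j → b.cartanMatrix j i ≠ 0 → c j = -c i := by
  have he (i : b.support) := exists_map_v_eq_smul φ (eG_ne_zero i) (isWeightVector_eG b i)
  have hf (i : b.support) := exists_map_v_eq_smul φ (γ := negIdx P i) (fG_ne_zero i)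
    ((isWeightVector_fG b i).congr (root_negIdx P i).symm)
  choose c hc₀ hc using he
  choose d hd₀ hd using hf
  have hu (i : b.support) : φ (u i) = -(c i • hG b i) := by
    rw [← fG_lie_v_same, ← LieModuleEquiv.coe_toLieModuleHom, LieModuleHom.map_lie]
    rw [LieModuleEquiv.coe_toLieModuleHom, hc, lie_smul, ← lie_skew, eG_lie_fG_same, smul_neg]
  -- `u_i` is both `f_i v_{α_i}` and `e_i v_{-α_i}`, and the two computations of `φ(u_i)` differ by
  -- the sign of `[f_i, e_i]`.
  have hcd (i : b.support) : d i = -c i := by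
    have h1 : φ (u i) = d i • hG b i := by
      rw [← eG_lie_v_neg, ← LieModuleEquiv.coe_toLieModuleHom, LieModuleHom.map_lie]
      rw [LieModuleEquiv.coe_toLieModuleHom, hd, lie_smul, eG_lie_fG_same]
    rw [hu, ← neg_smul] at h1
    exact (smul_left_injective ℂ (hG_ne_zero i) h1).symm
  refine ⟨c, hc₀, hc, fun i => by rw [hd, hcd, neg_smul], hu, fun i j hij hA => ?_⟩
  -- With `a` the Cartan entry, `φ(e_j u_i)` is `|a| c_j e_j = -a c_j e_j` in one reading and `c_i
  -- [h_i, e_j] = a c_i e_j` in the other.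
  have h1 : φ ⁅eG b j, u i⁆ = ⁅eG b j, φ (u i)⁆ :=
    LieModuleHom.map_lie φ.toLieModuleHom _ _
  have h2 : |b.cartanMatrix j i| = -b.cartanMatrix j i :=
    abs_of_nonpos (b.cartanMatrix_le_zero_of_ne j i hij.symm)
  have h3 : φ (((|b.cartanMatrix j i| : ℤ) : ℂ) • v b j) =
      ((|b.cartanMatrix j i| : ℤ) : ℂ) • φ (v b j) :=
    map_smul φ.toLieModuleHom _ _
  have h4 : (P.pairingIn ℤ j i : ℂ) = b.cartanMatrix j i := rfl
  rw [eG_lie_u, h3, hc, hu, lie_neg, lie_smul, ← lie_skew, hG_lie_eG, h2, smul_neg, neg_neg, h4,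
    smul_smul, smul_smul] at h1
  have h5 := smul_left_injective ℂ (eG_ne_zero j) h1
  push_cast at h5
  have h6 : (b.cartanMatrix j i : ℂ) ≠ 0 := by exact_mod_cast hA
  have h7 : (b.cartanMatrix j i : ℂ) * (c j + c i) = 0 := by linear_combination -h5
  exact eq_neg_of_add_eq_zero_left ((mul_eq_zero.mp h7).resolve_left h6)

theorem exists_isNormalized {ε : b.support → ℤˣ} (hε : IsAlternating b ε) :
    ∃ φ, IsNormalized b ε φ := by
  have : Nonempty ι := nonempty_index P
  obtain ⟨φ⟩ := exists_equiv b
  obtain ⟨c, hc₀, he, hf, hu, hc⟩ := exists_coeff φ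
  obtain ⟨i₀, hi₀⟩ := b.support_nonempty
  have hsq (i : b.support) : ((ε i : ℤ) : ℂ) * ((ε i : ℤ) : ℂ) = 1 := by
    norm_cast
    simp
  set t : ℂ := c ⟨i₀, hi₀⟩ * ((ε ⟨i₀, hi₀⟩ : ℤ) : ℂ) with ht
  -- `c` and `ε` change sign along the same edges, so their ratio is constant on the connected
  -- Dynkin diagram.
  have hct (i : b.support) : c i = t * ((ε i : ℤ) : ℂ) := by
    refine b.induction_on_cartanMatrix (fun i => c i = t * ((ε i : ℤ) : ℂ)) (i := ⟨i₀, hi₀⟩)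
      ?_ fun i j hi hij => ?_
    · rw [ht, mul_assoc, hsq, mul_one]
    · by_cases h : i = j
      · rwa [← h]
      · rw [hc i j h hij, hi, hε j i (Ne.symm h) hij]
        push_cast
        ring
  have ht0 : t ≠ 0 := fun h => hc₀ ⟨i₀, hi₀⟩ (by rw [hct, h, zero_mul])
  have hcε (i : b.support) : t⁻¹ * c i = ((ε i : ℤ) : ℂ) := by
    rw [hct, ← mul_assoc, inv_mul_cancel₀ ht0, one_mul]
  let ψ : Space b →ₗ⁅ℂ, Alg b⁆ Alg b := t⁻¹ • φ.toLieModuleHom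
  have hψ (m : Space b) : ψ m = t⁻¹ • φ m := rfl
  have hbij : Function.Bijective ψ := by
    constructor
    · intro m n h
      rw [hψ, hψ] at h
      exact φ.injective (smul_right_injective _ (inv_ne_zero ht0) h)
    · intro x
      refine ⟨t • φ.symm x, ?_⟩
      rw [map_smul, hψ, smul_smul, mul_inv_cancel₀ ht0, one_smul]
      exact φ.apply_symm_apply x
  refine ⟨ψ.equivOfBijective hbij, fun i => ?_, fun i => ?_, fun i => ?_⟩
  · change ψ _ = _
    rw [hψ, he, smul_smul, hcε]
  · change ψ _ = _
    rw [hψ, hf, smul_neg, smul_smul, hcε]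
  · change ψ _ = _
    rw [hψ, hu, smul_neg, smul_smul, hcε]

/-- Two morphisms from `M` which agree on some `u i` are equal. -/
lemma lieModuleHom_ext {Y : Type*} [AddCommGroup Y] [Module ℂ Y] [LieRingModule (Alg b) Y]
    [LieModule ℂ (Alg b) Y] {φ ψ : Space b →ₗ⁅ℂ, Alg b⁆ Y} (i : b.support)
    (h : φ (u i) = ψ (u i)) : φ = ψ := by
  have : Nonempty ι := ⟨i⟩
  have hker : (φ - ψ).ker = ⊤ := by
    refine (eq_bot_or_eq_top _).resolve_left fun h0 => ?_
    have h1 : u (R := ℂ) i ∈ (φ - ψ).ker := by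
      rw [LieModuleHom.mem_ker, LieModuleHom.sub_apply, h, sub_self]
    rw [h0, LieSubmodule.mem_bot] at h1
    simpa using congrFun h1 (Sum.inl i)
  ext1 m
  have h1 : m ∈ (φ - ψ).ker := hker ▸ LieSubmodule.mem_top m
  rwa [LieModuleHom.mem_ker, LieModuleHom.sub_apply, sub_eq_zero] at h1

theorem isNormalized_unique {ε : b.support → ℤˣ} {φ ψ : Space b ≃ₗ⁅ℂ, Alg b⁆ Alg b}
    (hφ : IsNormalized b ε φ) (hψ : IsNormalized b ε ψ) : φ = ψ := by
  have : Nonempty ι := nonempty_index P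
  obtain ⟨i₀, hi₀⟩ := b.support_nonempty
  have h := lieModuleHom_ext (φ := φ.toLieModuleHom) (ψ := ψ.toLieModuleHom) ⟨i₀, hi₀⟩
    ((hφ.map_u _).trans (hψ.map_u _).symm)
  exact LieModuleEquiv.ext _ _ fun m => LieModuleHom.congr_fun h m

end GeckChevalley

/-! ### The trace form and the structure constants -/

namespace GeckChevalley

variable {ι V W : Type*} [Fintype ι] [DecidableEq ι]
  [AddCommGroup V] [Module ℂ V] [AddCommGroup W] [Module ℂ W]
  {P : RootPairing ι ℂ V W} [P.IsCrystallographic] (b : P.Base)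

section Coroots

lemma hG_eq_corootG (i : b.support) : hG b i = corootG b i :=
  Subtype.ext (h_eq_diagonal i)

lemma exists_corootG_eq_sum [P.IsRootSystem] (α : ι) : ∃ c : b.support → ℂ,
    P.coroot α = ∑ i, c i • P.coroot i ∧ corootG b α = ∑ i, c i • hG b i := by
  have h : P.coroot α = ∑ i, b.toCoweightBasis.repr (P.coroot α) i • P.coroot i := by
    conv_lhs => rw [← b.toCoweightBasis.sum_repr (P.coroot α)]
    simp
  refine ⟨_, h, Subtype.ext ?_⟩
  have h1 (i : b.support) : (hG b i).1 = Matrix.diagonal (Sum.elim 0 fun β =>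
      (P.pairingIn ℤ β i : ℂ)) := h_eq_diagonal i
  rw [AddSubmonoidClass.coe_finsetSum]
  simp_rw [SetLike.val_smul, h1, ← Matrix.diagonal_smul]
  change Matrix.diagonal _ = _
  ext j k
  rw [Matrix.sum_apply]
  by_cases hjk : j = k
  · subst hjk
    rcases j with j | j
    · simp
    · simp only [Matrix.diagonal_apply_eq, Sum.elim_inr, Pi.smul_apply, smul_eq_mul,
        pairingIn_eq_toLinearMap]
      conv_lhs => rw [h, map_sum]
      simp only [map_smul, smul_eq_mul]
  · simp [hjk]

variable {b}

lemma IsWeightVector.corootG_lie [P.IsRootSystem] {X : Type*} [AddCommGroup X] [Module ℂ X]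
    [LieRingModule (Alg b) X] [LieModule ℂ (Alg b) X] {μ : V} {m : X} (hm : IsWeightVector b μ m)
    (α : ι) : ⁅corootG b α, m⁆ = P.toLinearMap μ (P.coroot α) • m := by
  obtain ⟨c, hc, hc'⟩ := exists_corootG_eq_sum b α
  rw [hc, hc', sum_lie, map_sum, Finset.sum_smul]
  exact Finset.sum_congr rfl fun i _ => by rw [smul_lie, hm i, map_smul, smul_smul, smul_eq_mul]

variable (b)

lemma isWeightVector_corootG [P.IsRootSystem] (α : ι) :
    IsWeightVector b (0 : V) (corootG b α) := fun i => by
  obtain ⟨c, -, hc'⟩ := exists_corootG_eq_sum b α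
  rw [hc', lie_sum, map_zero, LinearMap.zero_apply, zero_smul]
  exact Finset.sum_eq_zero fun j _ => by rw [lie_smul, hG_lie_hG, smul_zero]

local notation "κ" => LieModule.traceForm ℂ (Alg b) (Space b)

/-- Both sides are the sum over all roots `γ` of `(γ, α^∨)(γ, β^∨)`, since the `h_α` act diagonally
on `M` and kill the `u_i`. -/
lemma traceForm_corootG_corootG (α β : ι) :
    κ (corootG b α) (corootG b β) = P.CorootForm (P.coroot α) (P.coroot β) := by
  have h : κ (corootG b α) (corootG b β) =
      LinearMap.trace ℂ _ (Matrix.toLin' (corootMatrix b α * corootMatrix b β)) := by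
    rw [Matrix.toLin'_mul]
    rfl
  rw [h, Matrix.trace_toLin'_eq, corootMatrix, corootMatrix, Matrix.diagonal_mul_diagonal,
    Matrix.trace_diagonal, P.corootForm_apply_apply]
  simp [pairingIn_eq_toLinearMap, Fintype.sum_sum_type]

lemma eq_zero_of_traceForm_hG [P.IsRootSystem] (d : b.support → ℂ)
    (hd : ∀ j, κ (∑ i, d i • hG b i) (hG b j) = 0) : ∑ i, d i • hG b i = 0 := by
  have h0 : ∑ i, d i • P.coroot i = 0 := by
    refine P.flip.rootForm_nondegenerate.1 _ fun w => ?_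
    change P.CorootForm _ w = 0
    have hw : w ∈ Submodule.span ℂ (P.coroot '' b.support) := by
      rw [b.span_coroot_support]
      exact Submodule.eq_top_iff'.mp (IsRootSystem.span_coroot_eq_top (P := P)) w
    induction hw using Submodule.span_induction with
    | mem w hw =>
      obtain ⟨j, hj, rfl⟩ := hw
      rw [← hd ⟨j, hj⟩, map_sum, map_sum, LinearMap.sum_apply, LinearMap.sum_apply]
      refine Finset.sum_congr rfl fun i _ => ?_
      rw [map_smul, map_smul, LinearMap.smul_apply, LinearMap.smul_apply, hG_eq_corootG,
        hG_eq_corootG, traceForm_corootG_corootG]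
    | zero => exact map_zero _
    | add x y _ _ hx hy => rw [map_add, hx, hy, add_zero]
    | smul t x _ hx => rw [map_smul, hx, smul_zero]
  have h1 := Fintype.linearIndependent_iff.mp b.linearIndepOn_coroot d h0
  exact Finset.sum_eq_zero fun i _ => by rw [h1 i, zero_smul]

end Coroots

variable [P.IsRootSystem] [P.IsReduced] [P.IsIrreducible]
variable {b} {φ : Space b ≃ₗ⁅ℂ, Alg b⁆ Alg b} {ε : b.support → ℤˣ}

local notation "κ" => LieModule.traceForm ℂ (Alg b) (Space b)

omit [P.IsRootSystem] [P.IsReduced] [P.IsIrreducible] in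
lemma isWeightVector_map_v (φ : Space b ≃ₗ⁅ℂ, Alg b⁆ Alg b) (α : ι) :
    IsWeightVector b (P.root α) (φ (v b α)) :=
  (isWeightVector_v b α).map φ.toLieModuleHom

omit [P.IsReduced] [P.IsIrreducible] in
lemma IsWeightVector.exists_eq_smul_map_v (φ : Space b ≃ₗ⁅ℂ, Alg b⁆ Alg b) {γ : ι} {x : Alg b}
    (hx : IsWeightVector b (P.root γ) x) : ∃ t : ℂ, x = t • φ (v b γ) := by
  refine ⟨φ.symm.toLieModuleHom x (Sum.inr γ), ?_⟩
  rw [← map_smul φ, ← (hx.map φ.symm.toLieModuleHom).eq_smul_v]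
  exact (φ.apply_symm_apply x).symm

omit [P.IsReduced] [P.IsIrreducible] in
lemma lie_map_v_eq_zero (φ : Space b ≃ₗ⁅ℂ, Alg b⁆ Alg b) {α β : ι}
    (h₀ : P.root α + P.root β ≠ 0) (h₁ : P.root α + P.root β ∉ Set.range P.root) :
    ⁅φ (v b α), φ (v b β)⁆ = 0 := by
  have h := ((isWeightVector_map_v φ α).lie (isWeightVector_v b β)).eq_zero h₀ h₁
  rw [← LieModuleEquiv.coe_toLieModuleHom, ← LieModuleHom.map_lie φ.toLieModuleHom]
  exact (congrArg φ h).trans (map_zero φ)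

omit [P.IsRootSystem] [P.IsReduced] [P.IsIrreducible] in
lemma map_v_ne_zero (φ : Space b ≃ₗ⁅ℂ, Alg b⁆ Alg b) (α : ι) : φ (v b α) ≠ 0 := by
  rw [Ne, map_eq_zero_iff φ φ.injective]
  intro h
  simpa using congrFun h (Sum.inr α)

namespace IsNormalized

omit [P.IsReduced] [P.IsIrreducible] in
lemma exists_eq_sum_hG (hφ : IsNormalized b ε φ) {x : Alg b} (hx : IsWeightVector b (0 : V) x) :
    ∃ d : b.support → ℂ, x = ∑ i, d i • hG b i := by
  have h := (hx.map φ.symm.toLieModuleHom).eq_sum_u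
  set m := φ.symm.toLieModuleHom x with hm
  refine ⟨fun i => m (Sum.inl i) * -((ε i : ℤ) : ℂ), ?_⟩
  have h1 : x = φ m := (φ.apply_symm_apply x).symm
  rw [h1, h, map_sum]
  refine Finset.sum_congr rfl fun i _ => ?_
  rw [map_smul, hφ.map_u, mul_smul, neg_smul, ← h]

omit [P.IsRootSystem] [P.IsReduced] [P.IsIrreducible] in
/-- The elements `h i` and any nonzero multiples of the `φ (v α)` are the members of a basis. -/
lemma exists_basis (hφ : IsNormalized b ε φ) {t : ι → ℂ} (ht : ∀ α, t α ≠ 0) :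
    ∃ B : Module.Basis (b.support ⊕ ι) ℂ (Alg b),
      ⇑B = Sum.elim (hG b) fun α => t α • φ (v b α) := by
  let w : b.support ⊕ ι → ℂ := Sum.elim (fun i => -((ε i : ℤ) : ℂ)) t
  have hw (i) : IsUnit (w i) := by
    rcases i with i | α
    · rw [isUnit_iff_ne_zero]
      simp [w]
    · exact (ht α).isUnit
  refine ⟨((Pi.basisFun ℂ _).map φ.toLinearEquiv).isUnitSMul hw, ?_⟩
  ext1 i
  rw [Module.Basis.isUnitSMul_apply, Module.Basis.map_apply, Pi.basisFun_apply]
  rcases i with i | α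
  · have h : φ.toLinearEquiv (Pi.single (Sum.inl i) 1) = -(((ε i : ℤ) : ℂ) • hG b i) :=
      hφ.map_u i
    rw [h, show w (Sum.inl i) = -((ε i : ℤ) : ℂ) from rfl, Sum.elim_inl, neg_smul, smul_neg, neg_neg, smul_smul]
    norm_cast
    simp
  · rfl

/-- `φ` intertwines `ω` and `-omegaG`. -/
lemma omegaG_map (hφ : IsNormalized b ε φ) (m : Space b) :
    omegaG b (φ ((ω b).mulVec m)) = -φ m := by
  have : Nonempty ι := nonempty_index P
  obtain ⟨i, hi⟩ := b.support_nonempty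
  -- The twists by `ω` on the source and by `ω̃` on the target cancel, so this is a module morphism;
  -- the minus sign matches `ω̃(h_i) = -h_i`.
  let ψ : Space b →ₗ⁅ℂ, Alg b⁆ Alg b :=
    { toFun := fun m => -omegaG b (φ ((ω b).mulVec m))
      map_add' := fun m n => by rw [Matrix.mulVec_add, map_add, map_add, neg_add]
      map_smul' := fun t m => by
        rw [Matrix.mulVec_smul, map_smul, map_smul, smul_neg, RingHom.id_apply]
      map_lie' := fun {x m} => by
        change -omegaG b (φ ((ω b).mulVec ⁅x, m⁆)) = ⁅x, -omegaG b (φ ((ω b).mulVec m))⁆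
        rw [← omegaG_lie, show φ ⁅omegaG b x, (ω b).mulVec m⁆ = ⁅omegaG b x, φ ((ω b).mulVec m)⁆
          from LieModuleHom.map_lie φ.toLieModuleHom _ _, LieEquiv.map_lie, omegaG_omegaG, lie_neg] }
  have h : ψ = φ.toLieModuleHom := by
    refine lieModuleHom_ext ⟨i, hi⟩ ?_
    change -omegaG b (φ ((ω b).mulVec (u _))) = φ (u _)
    rw [ω_mulVec_u, hφ.map_u, map_neg, map_smul, omegaG_hG, smul_neg, neg_neg]
  rw [eq_neg_iff_add_eq_zero, add_comm, ← sub_neg_eq_add, sub_eq_zero]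
  exact (LieModuleHom.congr_fun h m).symm

lemma omegaG_map_v (hφ : IsNormalized b ε φ) (α : ι) :
    omegaG b (φ (v b α)) = -φ (v b (negIdx P α)) := by
  have h := hφ.omegaG_map (v b (negIdx P α))
  rwa [ω_mulVec_v, negIdx_negIdx] at h

omit [P.IsReduced] [P.IsIrreducible] in
/-- The bracket of opposite root vectors, in terms of the trace form. -/
lemma corootLength_smul_lie (hφ : IsNormalized b ε φ) {α : ι} {x y : Alg b}
    (hx : IsWeightVector b (P.root α) x) (hy : IsWeightVector b (-P.root α) y) :
    P.corootLength α • ⁅x, y⁆ = (2 * κ x y) • corootG b α := by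
  -- The difference of the two sides has weight zero, so it is a combination of the `h_i`;
  -- invariance of `κ` shows that it is orthogonal to every `h_j`, hence zero.
  have hw : IsWeightVector b (0 : V)
      (P.corootLength α • ⁅x, y⁆ - (2 * κ x y) • corootG b α) := fun i => by
    have h1 := ((hx.lie hy).congr (add_neg_cancel _)).smul (P.corootLength α) i
    have h2 := (isWeightVector_corootG b α).smul (2 * κ x y) i
    rw [lie_sub, h1, h2, smul_sub]
  obtain ⟨d, hd⟩ := hφ.exists_eq_sum_hG hw
  rw [← sub_eq_zero, hd]
  refine eq_zero_of_traceForm_hG b d fun j => ?_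
  have h1 : κ ⁅x, y⁆ (hG b j) = (P.pairingIn ℤ α j : ℂ) * κ x y := by
    rw [LieModule.traceForm_apply_lie_apply, ← lie_skew, hy j, map_neg (P.toLinearMap),
      LinearMap.neg_apply, neg_smul, neg_neg, map_smul, pairingIn_eq_toLinearMap, smul_eq_mul]
  have h2 := P.two_mul_corootForm α j
  rw [← hd, map_sub, map_smul, map_smul, LinearMap.sub_apply, LinearMap.smul_apply,
    LinearMap.smul_apply, h1, hG_eq_corootG, traceForm_corootG_corootG, smul_eq_mul, smul_eq_mul]
  linear_combination (-κ x y) * h2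

end IsNormalized

omit [P.IsRootSystem] [P.IsIrreducible] in
lemma two_mul_traceForm_eG_fG (i : b.support) : 2 * κ (eG b i) (fG b i) = P.corootLength i := by
  rw [corootLength, ← traceForm_corootG_corootG b, ← hG_eq_corootG]
  conv_rhs => rw [← eG_lie_fG_same, LieModule.traceForm_apply_lie_apply, eG_lie_fG_same,
    ← lie_skew, hG_lie_fG]
  simp

omit [DecidableEq ι] [P.IsCrystallographic] [P.IsRootSystem] [P.IsReduced] [P.IsIrreducible] in
lemma corootLength_negIdx (α : ι) : P.corootLength (negIdx P α) = P.corootLength α := by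
  simp [corootLength, negIdx]

lemma neg_one_zpow_neg (n : ℤ) : (-1 : ℂ) ^ (-n) = (-1) ^ n := by
  rw [zpow_neg, ← inv_zpow, inv_neg_one]

namespace IsNormalized

omit [P.IsRootSystem] [P.IsIrreducible] in
-- For `γ = β + α_j`, invariance of `κ` under `e_j` gives `(q + 1) κ(e_γ, e_{-γ}) = -p κ(e_β,
-- e_{-β})`. The string identity turns this into the ratio of coroot lengths, with one sign per unit
-- of height.
lemma two_mul_traceForm (hφ : IsNormalized b ε φ) (α : ι) :
    2 * κ (φ (v b α)) (φ (v b (negIdx P α))) = (-1) ^ b.height α * P.corootLength α := by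
  induction α using b.induction_add with
  | h₀ α ih =>
    change 2 * κ (φ (v b (negIdx P α))) (φ (v b (negIdx P (negIdx P α)))) =
      (-1) ^ b.height (negIdx P α) * P.corootLength (negIdx P α)
    rw [negIdx_negIdx, LieModule.traceForm_comm, ih, corootLength_negIdx, height_negIdx,
      neg_one_zpow_neg]
  | h₁ i hi =>
    have h1 : φ (v b i) = ((ε ⟨i, hi⟩ : ℤ) : ℂ) • eG b ⟨i, hi⟩ := hφ.map_v ⟨i, hi⟩
    have h2 : φ (v b (negIdx P i)) = -(((ε ⟨i, hi⟩ : ℤ) : ℂ) • fG b ⟨i, hi⟩) :=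
      hφ.map_v_neg ⟨i, hi⟩
    have hsq : ((ε ⟨i, hi⟩ : ℤ) : ℂ) * ((ε ⟨i, hi⟩ : ℤ) : ℂ) = 1 := by
      norm_cast
      simp
    have h3 := two_mul_traceForm_eG_fG (b := b) ⟨i, hi⟩
    rw [h1, h2, map_neg, map_smul, map_smul, LinearMap.smul_apply, smul_eq_mul, smul_eq_mul,
      b.height_one_of_mem_support hi, zpow_one, ← h3]
    linear_combination -2 * κ (eG b ⟨i, hi⟩) (fG b ⟨i, hi⟩) * hsq
  | h₂ β j γ hγ ih hj =>
    have hli : LinearIndependent ℂ ![P.root j, P.root β] :=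
      P.linearIndependent_of_add_mem_range_root' ⟨γ, by rw [hγ, add_comm]⟩
    have h1 : ⁅eG b ⟨j, hj⟩, φ (v b β)⁆ = (P.chainBotCoeff j β + 1 : ℂ) • φ (v b γ) := by
      rw [show ⁅eG b ⟨j, hj⟩, φ (v b β)⁆ = φ ⁅eG b ⟨j, hj⟩, v b β⁆ from
        (LieModuleHom.map_lie φ.toLieModuleHom _ _).symm, eG_lie_v b (by rw [hγ, add_comm]),
        map_smul]
    have h2 : ⁅eG b ⟨j, hj⟩, φ (v b (negIdx P γ))⁆ =
        (P.chainTopCoeff j β : ℂ) • φ (v b (negIdx P β)) := by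
      rw [show ⁅eG b ⟨j, hj⟩, φ (v b (negIdx P γ))⁆ = φ ⁅eG b ⟨j, hj⟩, v b (negIdx P γ)⁆ from
        (LieModuleHom.map_lie φ.toLieModuleHom _ _).symm,
        eG_lie_v b (j := negIdx P β) (by rw [root_negIdx, root_negIdx, hγ]; abel),
        map_smul, negIdx, chainBotCoeff_reflectionPerm_right, chainTopCoeff_of_add hli hγ]
      push_cast
      rfl
    have h3 := LieModule.traceForm_apply_lie_apply' ℂ (Alg b) (Space b) (eG b ⟨j, hj⟩)
      (φ (v b β)) (φ (v b (negIdx P γ)))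
    rw [h1, h2, map_smul, map_smul, LinearMap.smul_apply, smul_eq_mul, smul_eq_mul] at h3
    have h4 := P.chainTopCoeff_mul_corootLength hγ
    have h5 : (P.chainBotCoeff j β + 1 : ℂ) ≠ 0 := Nat.cast_add_one_ne_zero _
    apply mul_left_cancel₀ h5
    rw [b.height_add hγ, b.height_one_of_mem_support hj, zpow_add_one₀ (by norm_num)]
    linear_combination 2 * h3 - P.chainTopCoeff j β * ih - (-1) ^ b.height β * h4

omit [P.IsIrreducible] in
lemma lie_map_v_negIdx (hφ : IsNormalized b ε φ) (α : ι) :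
    ⁅φ (v b α), φ (v b (negIdx P α))⁆ = ((-1 : ℂ) ^ b.height α) • corootG b α := by
  have h := hφ.corootLength_smul_lie (isWeightVector_map_v φ α)
    ((isWeightVector_map_v φ (negIdx P α)).congr (root_negIdx P α))
  rw [hφ.two_mul_traceForm, mul_comm, mul_smul] at h
  exact smul_right_injective _ (P.corootLength_ne_zero α) h

/-- The composition of two opposite steps in a root string. -/
lemma lie_negIdx_lie (hφ : IsNormalized b ε φ) {α β : ι}
    (h : LinearIndependent ℂ ![P.root α, P.root β]) :
    ⁅φ (v b (negIdx P α)), ⁅φ (v b α), φ (v b β)⁆⁆ =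
      ((-1) ^ b.height α * (P.chainBotCoeff α β + 1) * P.chainTopCoeff α β : ℂ) • φ (v b β) := by
  induction hq : P.chainBotCoeff α β generalizing β with
  | zero =>
    have hpq : (P.chainBotCoeff α β - P.chainTopCoeff α β : ℂ) = P.pairingIn ℤ β α := by
      exact_mod_cast P.chainBotCoeff_sub_chainTopCoeff h
    -- At the bottom of the string only the term with `[e_α, e_{-α}]` survives in the Jacobi
    -- identity, and `(β, α^∨) = -p`.
    have h0 : ⁅φ (v b (negIdx P α)), φ (v b β)⁆ = 0 := by
      refine lie_map_v_eq_zero φ ?_ ?_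
      · rw [root_negIdx]
        intro h0
        have := LinearIndependent.pair_iff.mp h (-1) 1 (by simpa using h0)
        simp at this
      · rw [root_negIdx, neg_add_eq_sub]
        have := P.root_sub_nsmul_mem_range_iff_le_chainBotCoeff h (n := 1)
        rw [hq, one_smul] at this
        simp [this]
    have h1 := leibniz_lie (φ (v b α)) (φ (v b (negIdx P α))) (φ (v b β))
    rw [h0, lie_zero, hφ.lie_map_v_negIdx, smul_lie, (isWeightVector_map_v φ β).corootG_lie,
      ← pairingIn_eq_toLinearMap, ← hpq, hq, smul_smul] at h1
    rw [eq_neg_of_add_eq_zero_right h1.symm, ← neg_smul]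
    congr 1
    push_cast
    ring
  | succ n ih =>
    have hpq : (P.chainBotCoeff α β - P.chainTopCoeff α β : ℂ) = P.pairingIn ℤ β α := by
      exact_mod_cast P.chainBotCoeff_sub_chainTopCoeff h
    obtain ⟨δ, hδ⟩ : P.root β - P.root α ∈ Set.range P.root := by
      have := P.root_sub_nsmul_mem_range_iff_le_chainBotCoeff h (n := 1)
      rw [one_smul] at this
      rw [this]
      omega
    have hβ : P.root β = P.root δ + P.root α := by rw [hδ, sub_add_cancel]
    have hli : LinearIndependent ℂ ![P.root α, P.root δ] :=
      P.linearIndependent_of_add_mem_range_root' ⟨β, by rw [hβ, add_comm]⟩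
    have hq' : P.chainBotCoeff α δ = n := by
      have := P.chainBotCoeff_of_add hli hβ
      omega
    have hp' := P.chainTopCoeff_of_add hli hβ
    obtain ⟨N, hN⟩ := (((isWeightVector_map_v φ α).lie (isWeightVector_map_v φ δ)).congr
      (show _ = P.root β by rw [hβ, add_comm])).exists_eq_smul_map_v φ
    obtain ⟨N', hN'⟩ := (((isWeightVector_map_v φ (negIdx P α)).lie
      (isWeightVector_map_v φ β)).congr
      (show _ = P.root δ by rw [root_negIdx, hδ, neg_add_eq_sub])).exists_eq_smul_map_v φ
    -- The induction hypothesis at `δ = β - α` gives `N N' = (-1)^{ht α} (n + 1)(p + 1)`.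
    -- Subtracting `(-1)^{ht α} (n + 1 - p)`, from `[e_α, e_{-α}]` acting on `e_β`, leaves `(-1)^{ht
    -- α} (n + 2) p`.
    have h1 := ih hli hq'
    rw [hN, lie_smul, hN', smul_smul, hp'] at h1
    have h2 := smul_left_injective ℂ (map_v_ne_zero φ δ) h1
    have h3 := leibniz_lie (φ (v b α)) (φ (v b (negIdx P α))) (φ (v b β))
    rw [hN', lie_smul, hN, hφ.lie_map_v_negIdx, smul_lie, (isWeightVector_map_v φ β).corootG_lie,
      ← pairingIn_eq_toLinearMap, ← hpq, smul_smul, smul_smul] at h3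
    rw [← sub_eq_iff_eq_add'.mpr h3, ← sub_smul]
    congr 1
    rw [hq]
    push_cast at h2 ⊢
    linear_combination h2

theorem lie_map_v (hφ : IsNormalized b ε φ) {α β γ : ι} (hγ : P.root γ = P.root α + P.root β) :
    ∃ N : ℂ, (N = mMinus P α β ∨ N = -mMinus P α β) ∧
      ⁅φ (v b α), φ (v b β)⁆ = N • φ (v b γ) ∧
      ⁅φ (v b (negIdx P α)), φ (v b (negIdx P β))⁆ = (-N) • φ (v b (negIdx P γ)) := by
  have hli : LinearIndependent ℂ ![P.root α, P.root β] :=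
    P.linearIndependent_of_add_mem_range_root' ⟨γ, hγ⟩
  obtain ⟨N, hN⟩ := (((isWeightVector_map_v φ α).lie (isWeightVector_map_v φ β)).congr
    hγ.symm).exists_eq_smul_map_v φ
  obtain ⟨N', hN'⟩ := (((isWeightVector_map_v φ (negIdx P α)).lie
    (isWeightVector_map_v φ γ)).congr
    (show _ = P.root β by rw [root_negIdx, hγ, neg_add_cancel_left])).exists_eq_smul_map_v φ
  -- Apply `ω̃` to the relation defining `N`: three minus signs combine into one.
  have hneg : ⁅φ (v b (negIdx P α)), φ (v b (negIdx P β))⁆ = (-N) • φ (v b (negIdx P γ)) := by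
    have h := congrArg (omegaG b) hN
    rwa [LieEquiv.map_lie, map_smul, hφ.omegaG_map_v, hφ.omegaG_map_v, hφ.omegaG_map_v, neg_lie,
      lie_neg, neg_neg, smul_neg, ← neg_smul] at h
  refine ⟨N, ?_, hN, hneg⟩
  have h1 := hφ.lie_negIdx_lie hli
  rw [hN, lie_smul, hN', smul_smul] at h1
  have h2 := smul_left_injective ℂ (map_v_ne_zero φ β) h1
  have h3 := LieModule.traceForm_apply_lie_apply' ℂ (Alg b) (Space b) (φ (v b (negIdx P α)))
    (φ (v b γ)) (φ (v b (negIdx P β)))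
  rw [hN', hneg, map_smul, map_smul, LinearMap.smul_apply, smul_eq_mul, smul_eq_mul] at h3
  have hβ := hφ.two_mul_traceForm β
  have hγ' := hφ.two_mul_traceForm γ
  rw [b.height_add hγ, zpow_add₀ (by norm_num)] at hγ'
  have h4 := P.chainTopCoeff_mul_corootLength (hγ.trans (add_comm _ _))
  have hs (n : ℤ) : ((-1 : ℂ) ^ n) ≠ 0 := zpow_ne_zero _ (by norm_num)
  have h5 : N ^ 2 = (P.chainBotCoeff α β + 1 : ℂ) ^ 2 := by
    -- This compares `N' κ(e_β, e_{-β}) = N κ(e_γ, e_{-γ})` with the known values of `κ`.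
    -- Multiplying by `N` and inserting `N N'` and the string identity gives `N² = (q + 1)²`.
    have h6 : N' * P.corootLength β = N * (-1) ^ b.height α * P.corootLength γ := by
      apply mul_left_cancel₀ (hs (b.height β))
      linear_combination 2 * h3 - N' * hβ + N * hγ'
    apply mul_left_cancel₀ (mul_ne_zero (hs (b.height α)) (P.corootLength_ne_zero γ))
    linear_combination -N * h6 + P.corootLength β * h2 +
      (-1) ^ b.height α * (P.chainBotCoeff α β + 1) * h4
  rw [mMinus]
  push_cast
  exact sq_eq_sq_iff_eq_or_eq_neg.mp h5

end IsNormalized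

/-! ### Rescaling to a Chevalley basis -/

section Rescale

/-- The scaling factors of `rescale`. -/
noncomputable def rescaleFactor (b : P.Base) (α : ι) : ℂ :=
  if Even (b.height α) then 1 else Complex.I

omit [Fintype ι] [DecidableEq ι] [P.IsCrystallographic] [P.IsRootSystem] [P.IsReduced]
  [P.IsIrreducible] in
lemma rescaleFactor_ne_zero (α : ι) : rescaleFactor b α ≠ 0 := by
  rw [rescaleFactor]
  split_ifs <;> simp

omit [Fintype ι] [DecidableEq ι] [P.IsCrystallographic] [P.IsRootSystem] [P.IsReduced]
  [P.IsIrreducible] in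
lemma rescaleFactor_negIdx (α : ι) : rescaleFactor b (negIdx P α) = rescaleFactor b α := by
  simp only [rescaleFactor, height_negIdx, even_neg]

omit [Fintype ι] [DecidableEq ι] [P.IsCrystallographic] [P.IsRootSystem] [P.IsReduced]
  [P.IsIrreducible] in
lemma rescaleFactor_mul_self (α : ι) :
    rescaleFactor b α * rescaleFactor b α = (-1) ^ b.height α := by
  rw [rescaleFactor]
  split_ifs with h
  · rw [h.neg_one_zpow, one_mul]
  · rw [(Int.not_even_iff_odd.mp h).neg_one_zpow, Complex.I_mul_I]

omit [Fintype ι] [DecidableEq ι] [P.IsCrystallographic] [P.IsRootSystem] [P.IsReduced]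
  [P.IsIrreducible] in
-- The sign is `-1` exactly when both heights are odd. As `±α` have equal factors, the same sign
-- serves the negative roots, which preserves `N_{-α,-β} = -N_{α,β}`.
lemma exists_rescaleFactor_mul {α β γ : ι} (hγ : P.root γ = P.root α + P.root β) :
    ∃ σ : ℤˣ, rescaleFactor b α * rescaleFactor b β = ((σ : ℤ) : ℂ) * rescaleFactor b γ := by
  have h := b.height_add hγ
  simp only [rescaleFactor, h, Int.even_add]
  by_cases hα : Even (b.height α) <;> by_cases hβ : Even (b.height β)
  · exact ⟨1, by simp [hα, hβ]⟩
  · exact ⟨1, by simp [hα, hβ]⟩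
  · exact ⟨1, by simp [hα, hβ]⟩
  · exact ⟨-1, by simp [hα, hβ]⟩

omit [P.IsRootSystem] [P.IsReduced] [P.IsIrreducible] in
lemma rescale_apply (x : ι → Alg b) (α : ι) : rescale b x α = rescaleFactor b α • x α := by
  rw [rescale, rescaleFactor]
  split_ifs
  · rw [one_smul]
  · rfl

theorem IsNormalized.isChevalleyBasis (hφ : IsNormalized b ε φ) :
    IsChevalleyBasis b (rescale b fun α => φ (v b α)) := by
  have hx : (rescale b fun α => φ (v b α)) = fun α => rescaleFactor b α • φ (v b α) :=
    funext (rescale_apply _)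
  rw [hx]
  obtain ⟨B, hB⟩ := hφ.exists_basis (rescaleFactor_ne_zero (b := b))
  refine ⟨hB ▸ B.linearIndependent, hB ▸ B.span_eq, hG_lie_hG b, fun i α => ?_, fun α => ?_,
    fun α β γ hγ => ?_, fun α β h₀ h₁ => ?_⟩
  · rw [lie_smul, isWeightVector_map_v φ α i, pairingIn_eq_toLinearMap, smul_comm]
  · rw [smul_lie, lie_smul, smul_smul, hφ.lie_map_v_negIdx, rescaleFactor_negIdx,
      rescaleFactor_mul_self, smul_smul, ← zpow_add₀ (by norm_num), (Even.add_self _).neg_one_zpow,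
      one_smul]
  · obtain ⟨N, hN, h1, h2⟩ := hφ.lie_map_v hγ
    obtain ⟨σ, hσ⟩ := exists_rescaleFactor_mul (b := b) hγ
    obtain ⟨n, rfl, hn⟩ : ∃ n : ℤ, N = n ∧ (n = mMinus P α β ∨ n = -mMinus P α β) := by
      rcases hN with h | h
      · exact ⟨mMinus P α β, by simp [h], Or.inl rfl⟩
      · exact ⟨-mMinus P α β, by simp [h], Or.inr rfl⟩
    refine ⟨σ * n, ?_, ?_, ?_⟩
    · rcases Int.units_eq_one_or σ with rfl | rfl
      · simpa using hn
      · rcases hn with rfl | rfl <;> simp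
    · rw [smul_lie, lie_smul, h1, smul_smul, smul_smul, smul_smul, hσ]
      congr 1
      push_cast
      ring
    · rw [smul_lie, lie_smul, h2, smul_smul, smul_smul, smul_smul, rescaleFactor_negIdx,
        rescaleFactor_negIdx, rescaleFactor_negIdx, hσ]
      congr 1
      push_cast
      ring
  · rw [smul_lie, lie_smul, lie_map_v_eq_zero φ h₀ h₁, smul_zero, smul_zero]

end Rescale

end GeckChevalley

theorem theorem4p7 {ι V W : Type*} [Fintype ι] [DecidableEq ι]
    [AddCommGroup V] [Module ℂ V] [AddCommGroup W] [Module ℂ W]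
    (P : RootPairing ι ℂ V W) [P.IsRootSystem] [P.IsCrystallographic] [P.IsReduced]
    [P.IsIrreducible] (b : P.Base)
    (ε : b.support → ℤˣ) (hε : IsAlternating b ε) :
    (∃! φ : Space b ≃ₗ⁅ℂ, Alg b⁆ Alg b, IsNormalized b ε φ) ∧
    ∀ φ : Space b ≃ₗ⁅ℂ, Alg b⁆ Alg b, IsNormalized b ε φ →
      -- the vectors `h i` and `φ (v α)` form a basis
      LinearIndependent ℂ (Sum.elim (hG b) fun α => φ (v b α)) ∧
      Submodule.span ℂ (Set.range (Sum.elim (hG b) fun α => φ (v b α))) = ⊤ ∧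
      -- (a)
      (∀ α : ι, omegaG b (φ (v b α)) = -φ (v b (negIdx P α))) ∧
      -- (b)
      (∀ α : ι, ⁅φ (v b α), φ (v b (negIdx P α))⁆ = ((-1 : ℂ) ^ b.height α) • corootG b α) ∧
      -- (c)
      (∀ α β γ : ι, P.root γ = P.root α + P.root β →
        ∃ N : ℂ, (N = mMinus P α β ∨ N = -mMinus P α β) ∧
          ⁅φ (v b α), φ (v b β)⁆ = N • φ (v b γ)) ∧
      -- the rescaled vectors
      (∀ α : ι, omegaG b (rescale b (fun β => φ (v b β)) α) =
        -rescale b (fun β => φ (v b β)) (negIdx P α)) ∧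
      IsChevalleyBasis b (rescale b fun α => φ (v b α)) := by
  refine ⟨?_, fun φ hφ => ?_⟩
  · obtain ⟨φ, hφ⟩ := exists_isNormalized hε
    exact ⟨φ, hφ, fun ψ hψ => isNormalized_unique hψ hφ⟩
  · obtain ⟨B, hB⟩ := hφ.exists_basis (t := fun _ => 1) fun _ => one_ne_zero
    simp only [one_smul] at hB
    refine ⟨hB ▸ B.linearIndependent, hB ▸ B.span_eq, hφ.omegaG_map_v, hφ.lie_map_v_negIdx,
      fun α β γ hγ => ?_, fun α => ?_, hφ.isChevalleyBasis⟩
    · obtain ⟨N, hN, h, -⟩ := hφ.lie_map_v hγ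
      exact ⟨N, hN, h⟩
    · rw [rescale_apply, rescale_apply, map_smul, hφ.omegaG_map_v, rescaleFactor_negIdx, smul_neg]
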